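/- Let $n\ge1$, $\theta_1\in(1,2]$ and $M>0$. Let $a\in\mathcal C^{n+1}(\mathbb R^n\setminus\{0\})$ be real valued with $a(\xi)>0$ for $\xi\neq0$, and suppose that for some $a_1,C_0>0$, $$a(\xi)\ge a_1|\xi|^{\theta_1},\qquad |\partial_\xi^\gamma a(\xi)|\le C_0|\xi|^{\theta_1-|\gamma|}\qquad\text{for all } |\xi|\ge M,\ |\gamma|\le n+1,$$ where $M$ is so large that also $a(\xi)\ge4|\xi|$ for $|\xi|\ge M$. Let $\hat K(t,\xi)$ be the solution of $\hat K_{tt}+a(\xi)\hat K_t+|\xi|^2\hat K=0$, $\hat K(0,\xi)=0$, $\hat K_t(0,\xi)=1$. Let $\chi\in\mathcal C_c^\infty(\mathbb R^n)$ be real valued with $\chi=1$ for $|\xi|\le1$ and $\chi=0$ for $|\xi|\ge2$, and let $K_1(t,\cdot)=\mathscr F^{-1}\big(\hat K(t,\xi)\,(1-\chi(\xi/M))\big)$, where $\hat f(\xi)=\int e^{-ix\cdot\xi}f(x)\,dx$. For $1\le p\le q\le\infty$ and a tempered distribution $T$ put $\|T\|_{L_p^q}=\sup\{\|T*f\|_{L^q}: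 f\in\mathcal S,\ \|f\|_{L^p}=1\}$. Write $s_+=\max\{s,0\}$ and $1/\infty=0$. Then for every $t>0$ the function $\hat K(t,\cdot)(1-\chi(\cdot/M))$ is in $L^\infty$ (so that $K_1(t,\cdot)$ is a tempered distribution), and the following hold. 1. Let $\theta_1<2$ and $1\le p\le q\le\infty$. Call $(p,q)$ critical if $p=1$ and $n(1-1/q)=\theta_1$, or $q=\infty$ and $n/p=\theta_1$. If $(p,q)$ is not critical, there are $C,c>0$, independent of $t$, such that $$\|K_1(t,\cdot)\|_{L_p^q}\le C\,t^{-\frac1{2-\theta_1}\left(n\left(\frac1p-\frac1q\right)-\theta_1\right)_+}e^{-ct}\qquad\text{for all }t>0.$$ If $(p,q)$ is critical, there is $c>0$ such that for every $\varepsilon>0$ there is $C_\varepsilon>0$ with $$\|K_1(t,\cdot)\|_{L_p^q}\le C_\varepsilon\,t^{-\varepsilon}e^{-ct}\qquad\text{for all }t>0.$$ 2. Let $\theta_1=2$ and $1\le p\le q\le\infty$, and assume that one of the following holds: $1<p\le q<\infty$ and $n(1/p-1/q)\le2$; or $p=1$ and $n(1-1/q)<2$; or $q=\infty$ and $n/p<2$.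 Then there are $C,c>0$, independent of $t$, such that $\|K_1(t,\cdot)\|_{L_p^q}\le C\,e^{-ct}$ for all $t>0$. -/

import Mathlib

open MeasureTheory
open scoped ENNReal SchwartzMap FourierTransform

noncomputable section

/-- The solution `y` of the damped oscillator
`y'' + α y' + r² y = 0`, `y 0 = 0`, `y' 0 = 1`.
If `α² > 4 r²` it is `(exp (λ₊ t) - exp (λ₋ t)) / (λ₊ - λ₋)` with
`λ± = (-α ± √(α² - 4 r²)) / 2`; otherwise it is
`exp (-(α / 2) t) * t * sinc (t √(r² - α² / 4))`. -/
def dampedOscillator (α r t : ℝ) : ℝ :=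
  if 4 * r ^ 2 < α ^ 2 then
    (Real.exp ((-α + √(α ^ 2 - 4 * r ^ 2)) / 2 * t)
        - Real.exp ((-α - √(α ^ 2 - 4 * r ^ 2)) / 2 * t))
      / ((-α + √(α ^ 2 - 4 * r ^ 2)) / 2 - (-α - √(α ^ 2 - 4 * r ^ 2)) / 2)
  else
    Real.exp (-(α / 2) * t) * (t * Real.sinc (t * √(r ^ 2 - α ^ 2 / 4)))

/-- `dampedOscillator α r` does solve the Cauchy problem that describes it. -/
theorem dampedOscillator_spec (α r : ℝ) :
    ∃ v : ℝ → ℝ,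
      (∀ t, HasDerivAt (dampedOscillator α r) (v t) t) ∧
      (∀ t, HasDerivAt v (-(α * v t) - r ^ 2 * dampedOscillator α r t) t) ∧
      dampedOscillator α r 0 = 0 ∧ v 0 = 1 := by
  by_cases h : 4 * r ^ 2 < α ^ 2
  · have hD : 0 < α ^ 2 - 4 * r ^ 2 := by linarith
    have hs : 0 < √(α ^ 2 - 4 * r ^ 2) := Real.sqrt_pos.mpr hD
    have hs2 : √(α ^ 2 - 4 * r ^ 2) ^ 2 = α ^ 2 - 4 * r ^ 2 := Real.sq_sqrt hD.le
    have hf : dampedOscillator α r = fun t =>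
        (Real.exp ((-α + √(α ^ 2 - 4 * r ^ 2)) / 2 * t)
          - Real.exp ((-α - √(α ^ 2 - 4 * r ^ 2)) / 2 * t))
        / ((-α + √(α ^ 2 - 4 * r ^ 2)) / 2 - (-α - √(α ^ 2 - 4 * r ^ 2)) / 2) := by
      funext t; simp [dampedOscillator, h]
    set s := √(α ^ 2 - 4 * r ^ 2)
    have hE : ∀ l t : ℝ, HasDerivAt (fun t => Real.exp (l * t)) (l * Real.exp (l * t)) t := by
      intro l t
      have := ((hasDerivAt_id t).const_mul l).exp
      simpa [mul_comm] using this
    have hne : (-α + s) / 2 - (-α - s) / 2 ≠ 0 := by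
      have : (-α + s) / 2 - (-α - s) / 2 = s := by ring
      rw [this]; exact hs.ne'
    refine ⟨fun t => ((-α + s) / 2 * Real.exp ((-α + s) / 2 * t)
      - (-α - s) / 2 * Real.exp ((-α - s) / 2 * t)) / ((-α + s) / 2 - (-α - s) / 2),
      ?_, ?_, ?_, ?_⟩
    · intro t; rw [hf]
      exact ((hE _ t).sub (hE _ t)).div_const _
    · intro t; rw [hf]
      have := (((hE ((-α + s) / 2) t).const_mul ((-α + s) / 2)).sub
        ((hE ((-α - s) / 2) t).const_mul ((-α - s) / 2))).div_const
          ((-α + s) / 2 - (-α - s) / 2)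
      refine this.congr_deriv ?_
      have h1 : ((-α + s) / 2) * ((-α + s) / 2) = -α * ((-α + s) / 2) - r ^ 2 := by
        linear_combination hs2 / 4
      have h2 : ((-α - s) / 2) * ((-α - s) / 2) = -α * ((-α - s) / 2) - r ^ 2 := by
        linear_combination hs2 / 4
      rw [← mul_assoc, ← mul_assoc, h1, h2]
      field_simp
      ring
    · rw [hf]; simp
    · simp only [mul_zero, Real.exp_zero, mul_one]
      exact div_self hne
  · have hw : 0 ≤ r ^ 2 - α ^ 2 / 4 := by linarith
    have hw2 : √(r ^ 2 - α ^ 2 / 4) ^ 2 = r ^ 2 - α ^ 2 / 4 := Real.sq_sqrt hw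
    have hf : dampedOscillator α r = fun t =>
        Real.exp (-(α / 2) * t) * (t * Real.sinc (t * √(r ^ 2 - α ^ 2 / 4))) := by
      funext t; simp [dampedOscillator, h]
    set w := √(r ^ 2 - α ^ 2 / 4)
    have hS : ∀ t, HasDerivAt (fun t => t * Real.sinc (t * w)) (Real.cos (w * t)) t := by
      intro t
      by_cases hw0 : w = 0
      · simpa [hw0] using hasDerivAt_id' t
      · have e : (fun t => t * Real.sinc (t * w)) = fun t => Real.sin (w * t) / w := by
          funext u
          by_cases hu : u = 0
          · simp [hu]
          · rw [Real.sinc_of_ne_zero (mul_ne_zero hu hw0), mul_comm w u]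
            field_simp
        rw [e]
        have := (((hasDerivAt_id t).const_mul w).sin).div_const w
        refine this.congr_deriv ?_
        simp [hw0]
    have hC : ∀ t, HasDerivAt (fun t => Real.cos (w * t))
        (-(w ^ 2 * (t * Real.sinc (t * w)))) t := by
      intro t
      have := ((hasDerivAt_id t).const_mul w).cos
      refine this.congr_deriv ?_
      by_cases hw0 : w = 0
      · simp [hw0]
      · by_cases ht : t = 0
        · simp [ht]
        · rw [Real.sinc_of_ne_zero (mul_ne_zero ht hw0), mul_comm t w]
          simp only [id_eq, mul_one]
          field_simp
    have hE : ∀ t, HasDerivAt (fun t => Real.exp (-(α / 2) * t))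
        (-(α / 2) * Real.exp (-(α / 2) * t)) t := by
      intro t
      have := ((hasDerivAt_id t).const_mul (-(α / 2))).exp
      simpa [mul_comm] using this
    refine ⟨fun t => -(α / 2) * Real.exp (-(α / 2) * t) * (t * Real.sinc (t * w))
      + Real.exp (-(α / 2) * t) * Real.cos (w * t), ?_, ?_, ?_, ?_⟩
    · intro t; rw [hf]; exact (hE t).mul (hS t)
    · intro t; rw [hf]
      have := (((hE t).const_mul (-(α / 2))).mul (hS t)).add ((hE t).mul (hC t))
      refine this.congr_deriv ?_
      linear_combination
        (-(Real.exp (-(α / 2) * t) * (t * Real.sinc (t * w)))) * hw2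
    · rw [hf]; simp
    · simp

/-- The iterated partial derivative `∂_{γ 0} ⋯ ∂_{γ (k-1)} f` at `ξ`.  The partial derivatives
`∂^γ f` of order `k` are those of this form. -/
def partialDeriv {n k : ℕ} (γ : Fin k → Fin n) (f : EuclideanSpace ℝ (Fin n) → ℝ)
    (ξ : EuclideanSpace ℝ (Fin n)) : ℝ :=
  iteratedFDeriv ℝ k f ξ (fun i => EuclideanSpace.single (γ i) (1 : ℝ))

/-- High-frequency assumption on the symbol: for some `a₁, C > 0`,
`a ξ ≥ a₁ |ξ|^θ` and `|∂^γ a ξ| ≤ C |ξ|^(θ - |γ|)` for all `|ξ| ≥ M` and `|γ| ≤ n + 1`. -/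
def HighFrequencySymbol {n : ℕ} (a : EuclideanSpace ℝ (Fin n) → ℝ) (θ M : ℝ) : Prop :=
  ∃ a₁ > (0 : ℝ), ∃ C > (0 : ℝ), ∀ ξ : EuclideanSpace ℝ (Fin n), M ≤ ‖ξ‖ →
    a₁ * ‖ξ‖ ^ θ ≤ a ξ ∧
    ∀ k ≤ n + 1, ∀ γ : Fin k → Fin n, |partialDeriv γ a ξ| ≤ C * ‖ξ‖ ^ (θ - (k : ℝ))

/-- A smooth cut-off: `χ = 1` for `|ξ| ≤ 1` and `χ = 0` for `|ξ| ≥ 2`. -/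
structure IsCutoff {n : ℕ} (χ : EuclideanSpace ℝ (Fin n) → ℝ) : Prop where
  smooth : ContDiff ℝ ((⊤ : ℕ∞) : WithTop ℕ∞) χ
  eq_one : ∀ ξ, ‖ξ‖ ≤ 1 → χ ξ = 1
  eq_zero : ∀ ξ, 2 ≤ ‖ξ‖ → χ ξ = 0

/-- The symbol of the fundamental solution of `u_tt - Δu + A u_t = 0` localized at high
frequencies: `K̂(t, ξ) φ₁(ξ)` with `φ₁(ξ) = 1 - χ(ξ / M)`. -/
def highFreqSymbol {n : ℕ} (a χ : EuclideanSpace ℝ (Fin n) → ℝ) (M t : ℝ)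
    (ξ : EuclideanSpace ℝ (Fin n)) : ℂ :=
  ((dampedOscillator (a ξ) ‖ξ‖ t * (1 - χ (M⁻¹ • ξ)) : ℝ) : ℂ)

open Classical in
/-- The tempered distribution `g ↦ ∫ g m` of a function `m ∈ L^∞` (and `0` if `m ∉ L^∞`). -/
def distributionOfBounded {n : ℕ} (m : EuclideanSpace ℝ (Fin n) → ℂ) :
    𝓢'(EuclideanSpace ℝ (Fin n), ℂ) :=
  if h : MemLp m ∞ volume then Lp.toTemperedDistribution (h.toLp m) else 0

/-- The inverse Fourier transform, as a tempered distribution, of a bounded function `m`, in the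
normalization `f̂(ξ) = ∫ exp(-i x·ξ) f(x) dx`.  Mathlib's transform has the phase
`exp(-2π i x·ξ)`, whence the dilation. -/
def inverseFourier {n : ℕ} (m : EuclideanSpace ℝ (Fin n) → ℂ) :
    𝓢'(EuclideanSpace ℝ (Fin n), ℂ) :=
  𝓕⁻ (distributionOfBounded fun η => m ((2 * Real.pi) • η))

/-- `⟨F⁻¹ m, g⟩ = ∫ m(ξ) (2π)⁻ⁿ (∫ exp(i x·ξ) g(x) dx) dξ`. -/
theorem inverseFourier_apply {n : ℕ} (m : EuclideanSpace ℝ (Fin n) → ℂ)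
    (hm : MemLp (fun η => m ((2 * Real.pi) • η)) ∞ volume)
    (g : 𝓢(EuclideanSpace ℝ (Fin n), ℂ)) :
    inverseFourier m g = ∫ ξ, m ξ * (((2 * Real.pi : ℝ) : ℂ) ^ n)⁻¹ *
      ∫ x, Complex.exp (Complex.I * ((inner ℝ x ξ : ℝ) : ℂ)) * g x := by
  have hpi : (0 : ℝ) < 2 * Real.pi := by positivity
  have h1 : inverseFourier m g = ∫ η, (𝓕⁻ g) η * m ((2 * Real.pi) • η) := by
    rw [inverseFourier, TemperedDistribution.fourierInv_apply, distributionOfBounded, dif_pos hm,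
      Lp.toTemperedDistribution_apply]
    apply integral_congr_ae
    filter_upwards [hm.coeFn_toLp] with η hη
    rw [hη, smul_eq_mul]
  have h2 : ∀ η : EuclideanSpace ℝ (Fin n), (𝓕⁻ g) η =
      ∫ x, Complex.exp (Complex.I * ((inner ℝ x ((2 * Real.pi) • η) : ℝ) : ℂ)) * g x := by
    intro η
    rw [SchwartzMap.fourierInv_coe, Real.fourierInv_eq']
    apply integral_congr_ae
    filter_upwards with x
    rw [smul_eq_mul, inner_smul_right]
    congr 2
    push_cast
    ring
  rw [h1]
  simp_rw [h2]
  have h3 := Measure.integral_comp_smul_of_nonneg (volume : Measure (EuclideanSpace ℝ (Fin n)))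
    (fun ξ => (∫ x, Complex.exp (Complex.I * ((inner ℝ x ξ : ℝ) : ℂ)) * g x) * m ξ)
    (2 * Real.pi) (hR := hpi.le)
  rw [h3, finrank_euclideanSpace_fin, ← integral_smul]
  apply integral_congr_ae
  filter_upwards with ξ
  rw [Complex.real_smul]
  push_cast
  ring

/-- The Schwartz function `y ↦ f (x - y)`. -/
def reflectTranslate {n : ℕ} (f : 𝓢(EuclideanSpace ℝ (Fin n), ℂ))
    (x : EuclideanSpace ℝ (Fin n)) : 𝓢(EuclideanSpace ℝ (Fin n), ℂ) :=
  SchwartzMap.compCLMOfAntilipschitz ℂ (g := fun y => x - y) (K := 1) (by fun_prop)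
    (fun _ _ => by simp [edist_dist, dist_eq_norm, norm_sub_rev]) f

/-- The convolution `T ∗ f` of a tempered distribution and a Schwartz function, that is, the
function `x ↦ T (f (x - ·))`. -/
def distributionConv {n : ℕ} (T : 𝓢'(EuclideanSpace ℝ (Fin n), ℂ))
    (f : 𝓢(EuclideanSpace ℝ (Fin n), ℂ)) : EuclideanSpace ℝ (Fin n) → ℂ :=
  fun x => T (reflectTranslate f x)

/-- `‖T‖_{L_p^q} = sup {‖T ∗ f‖_{L^q} : f ∈ 𝓢, ‖f‖_{L^p} = 1}`, with value `∞` if `T` does not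
define a bounded operator from `L^p` to `L^q`. -/
def convNorm {n : ℕ} (p q : ℝ≥0∞) (T : 𝓢'(EuclideanSpace ℝ (Fin n), ℂ)) : ℝ≥0∞ :=
  ⨆ (f : 𝓢(EuclideanSpace ℝ (Fin n), ℂ)) (_ : eLpNorm f p volume = 1),
    eLpNorm (distributionConv T f) q volume

/-- `K₁(t, ·)`, the fundamental solution localized at high frequencies. -/
def highFreqKernel {n : ℕ} (a χ : EuclideanSpace ℝ (Fin n) → ℝ) (M t : ℝ) :
    𝓢'(EuclideanSpace ℝ (Fin n), ℂ) :=
  inverseFourier (highFreqSymbol a χ M t)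

/-- The endpoint critical cases: `p = 1` and `n (1 - 1/q) = θ`, or `q = ∞` and `n/p = θ`. -/
def IsCriticalEndpoint (n : ℕ) (θ : ℝ) (p q : ℝ≥0∞) : Prop :=
  (p = 1 ∧ (n : ℝ) * (1 - (1 / q).toReal) = θ) ∨ (q = ∞ ∧ (n : ℝ) * (1 / p).toReal = θ)

end

/-!
The multiplier `K̂(t, ξ) (1 - χ(ξ / M))` is cut dyadically into pieces at the frequencies
`L = 2 ^ j M`. At high frequencies the oscillator is overdamped, with roots `λ₊ ≈ -|ξ|² / a(ξ)` and
`λ₋ ≈ -a(ξ)`, so `K̂` is of size `|ξ| ^ (-θ) exp (-c t |ξ| ^ (2 - θ))` and obeys symbol estimates up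
to order `n + 1` that are uniform in `t` (`bddJets_rescaled_multiplier`): a factor `τ ^ k` that a
derivative takes from `exp (-τ)` is absorbed by half of the exponential. Since `n + 1` derivatives
of a compactly supported function give decay of order `n + 1` of its Fourier transform, the kernel
of the piece at frequency `L` is bounded by `L ^ (-θ) exp (-c t L ^ (2 - θ))` times a bump of width
`1 / L` with bounded `L¹` norm (`exists_dyadic_kernels`).

Convolution with this bump maps `L^p` to `L^q` with norm `O(L ^ (n (1/p - 1/q)))` by Young's
inequality (`eLpNorm_bumpKernel_conv_le`). With `s = n (1/p - 1/q) - θ`, the operator norm is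
therefore at most a constant times `exp (-c t)` times the sum over `L` of
`L ^ s exp (-c t L ^ (2 - θ))` (`convNorm_highFreqKernel_le_tsum`). For `s < 0` this sum is dominated
by a convergent geometric series; for `s > 0` and `θ < 2` it is `O(t ^ (-s / (2 - θ)))`; for `s = 0`
and `θ < 2` it is `O(t ^ (-ε))`, which settles the critical endpoints.

When `s = 0`, `1 < p` and `q < ∞`, the loss `t ^ (-ε)` is avoided, also for `θ = 2`, by adding up
the kernels instead of their norms: their sum is at most `C exp (-c t) |x| ^ (θ - n)`
(`tsum_bumpKernel_le`), and the claim is the Hardy–Littlewood–Sobolev inequality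
(`lintegral_potential_rpow_le`), which is proved along the way.
-/

/-! ### The Hardy–Littlewood–Sobolev and Young inequalities -/

section PotentialKernel

variable {E : Type*} [NormedAddCommGroup E] [NormedSpace ℝ E] [FiniteDimensional ℝ E]
  [MeasurableSpace E] [BorelSpace E] (μ : Measure E) [μ.IsAddHaarMeasure]

theorem lintegral_comp_inv_smul {R : ℝ} (hR : 0 < R) (F : E → ℝ≥0∞) :
    ∫⁻ x, F (R⁻¹ • x) ∂μ = ENNReal.ofReal (R ^ Module.finrank ℝ E) * ∫⁻ x, F x ∂μ := by
  have h0 : R⁻¹ ≠ 0 := inv_ne_zero hR.ne'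
  have h := (Homeomorph.smulOfNeZero (α := E) R⁻¹ h0).measurableEmbedding.lintegral_map (μ := μ) F
  have h2 : Measure.map (⇑(Homeomorph.smulOfNeZero (α := E) R⁻¹ h0)) μ
      = ENNReal.ofReal |(R⁻¹ ^ Module.finrank ℝ E)⁻¹| • μ := Measure.map_addHaar_smul μ h0
  rw [h2, lintegral_smul_measure] at h
  rw [inv_pow, inv_inv, abs_of_pos (by positivity)] at h
  exact h.symm

theorem lintegral_mul_enorm_rpow_scale {R : ℝ} (hR : 0 < R) (l : ℝ) (φ : E → ℝ≥0∞) :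
    ∫⁻ x, φ (R⁻¹ • x) * ‖x‖ₑ ^ (-l) ∂μ =
      ENNReal.ofReal (R ^ (Module.finrank ℝ E - l)) * ∫⁻ x, φ x * ‖x‖ₑ ^ (-l) ∂μ := by
  have hR0 : ENNReal.ofReal R ≠ 0 := by simpa using hR
  have key : ∀ x : E, φ (R⁻¹ • x) * ‖x‖ₑ ^ (-l) =
      ENNReal.ofReal (R ^ (-l)) * (fun z => φ z * ‖z‖ₑ ^ (-l)) (R⁻¹ • x) := by
    intro x
    have : ‖x‖ₑ = ENNReal.ofReal R * ‖R⁻¹ • x‖ₑ := by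
      conv_lhs => rw [← smul_inv_smul₀ hR.ne' x]
      rw [enorm_smul, Real.enorm_eq_ofReal hR.le]
    simp only
    rw [this, ENNReal.mul_rpow_eq_ite]
    simp only [hR0, ENNReal.ofReal_ne_top, false_and, or_self, if_false]
    rw [ENNReal.ofReal_rpow_of_pos hR]
    ring
  simp_rw [key]
  rw [lintegral_const_mul' _ _ ENNReal.ofReal_ne_top,
    lintegral_comp_inv_smul μ hR (fun z => φ z * ‖z‖ₑ ^ (-l)), ← mul_assoc,
    ← ENNReal.ofReal_mul (by positivity), ← Real.rpow_natCast, ← Real.rpow_add hR]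
  congr 3; ring

theorem lintegral_ball_enorm_rpow_lt_top [Nontrivial E] {l : ℝ} (hl : l < Module.finrank ℝ E) :
    ∫⁻ x, (Metric.ball (0 : E) 1).indicator 1 x * ‖x‖ₑ ^ (-l) ∂μ < ∞ := by
  have h1 : IntegrableOn (fun x : E => ‖x‖ ^ (-l)) (Metric.ball 0 1) μ := by
    refine integrableOn_ball_of_norm_le_rpow (C := 1) (α := l) Module.finrank_pos hl ?_
      (by fun_prop : Measurable _).aestronglyMeasurable
    filter_upwards with x
    rw [Real.norm_of_nonneg (by positivity), one_mul]
  have h2 := h1.2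
  rw [HasFiniteIntegral, ← lintegral_indicator measurableSet_ball] at h2
  refine lt_of_eq_of_lt (lintegral_congr_ae ?_) h2
  have h0 : ∀ᵐ x ∂μ, x ≠ 0 := by simp [ae_iff]
  filter_upwards [h0] with x hx
  by_cases hb : x ∈ Metric.ball (0 : E) 1
  · rw [Set.indicator_of_mem hb, Set.indicator_of_mem hb, Pi.one_apply, one_mul,
      Real.enorm_eq_ofReal (by positivity), ← ofReal_norm,
      ENNReal.ofReal_rpow_of_pos (norm_pos_iff.mpr hx)]
  · simp [hb]

theorem lintegral_compl_ball_enorm_rpow_lt_top {l : ℝ} (hl : Module.finrank ℝ E < l) :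
    ∫⁻ x, (Metric.ball (0 : E) 1)ᶜ.indicator 1 x * ‖x‖ₑ ^ (-l) ∂μ < ∞ := by
  have hl0 : 0 < l := lt_of_le_of_lt (by positivity) hl
  have h := finite_integral_one_add_norm (μ := μ) hl
  refine lt_of_le_of_lt (b := ENNReal.ofReal (2 ^ l) *
    ∫⁻ x : E, ENNReal.ofReal ((1 + ‖x‖) ^ (-l)) ∂μ) ?_ (ENNReal.mul_lt_top (by simp) h)
  rw [← lintegral_const_mul' _ _ ENNReal.ofReal_ne_top]
  refine lintegral_mono fun x => ?_
  by_cases hb : x ∈ Metric.ball (0 : E) 1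
  · simp [hb]
  · have hx : 1 ≤ ‖x‖ := by simpa using hb
    rw [Set.indicator_of_mem (by simpa using hx), Pi.one_apply, one_mul, ← ofReal_norm,
      ENNReal.ofReal_rpow_of_pos (by linarith), ← ENNReal.ofReal_mul (by positivity)]
    refine ENNReal.ofReal_le_ofReal ?_
    have : ‖x‖ ^ (-l) = 2 ^ l * (2 * ‖x‖) ^ (-l) := by
      rw [Real.mul_rpow (by norm_num) (by positivity), ← mul_assoc, ← Real.rpow_add (by norm_num)]
      simp
    rw [this]
    refine mul_le_mul_of_nonneg_left ?_ (by positivity)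
    exact Real.rpow_le_rpow_of_nonpos (by positivity) (by linarith) (by linarith)

/-- The estimate behind the Hardy–Littlewood–Sobolev inequality: where `h ^ s ≤ v ^ p`, the
potential of `h` is at most `C v ^ (p - 1)`. Near the singularity this uses `h ≤ v ^ (p / s)`, away
from it Hölder's inequality. -/
theorem lintegral_superlevel_mul_potential_le [Nontrivial E] {l p s : ℝ} (hp : 1 < p) (hs : 1 < s)
    (hl : l < Module.finrank ℝ E) (hl0 : 0 < l) (hps : 1 / p + 1 / s + l / Module.finrank ℝ E = 2) :
    ∃ C : ℝ≥0∞, C < ∞ ∧ ∀ h : E → ℝ≥0∞, Measurable h → ∫⁻ x, h x ^ s ∂μ ≤ 1 →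
      ∀ (v : ℝ≥0∞) (y : E),
        v * ∫⁻ x, {x | h x ^ s ≤ v ^ p}.indicator (fun x => h x * ‖x - y‖ₑ ^ (-l)) x ∂μ
          ≤ C * v ^ p := by
  set d : ℝ := (Module.finrank ℝ E : ℝ) with hd
  have hd0 : 0 < d := hl0.trans hl
  set s' := s / (s - 1) with hs'
  have hss : s.HolderConjugate s' := Real.HolderConjugate.conjExponent hs
  have hs'0 : 0 < s' := hss.symm.pos
  have hs'inv : 1 / s' = 1 - 1 / s := by
    have := hss.inv_add_inv_eq_one; simp only [one_div]; linarith
  have hp1 : 1 / p < 1 := by rw [div_lt_one (by linarith)]; exact hp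
  have hls' : d < l * s' := by
    have h1 : 1 / s' < l / d := by rw [hs'inv]; linarith
    rw [div_lt_div_iff₀ hs'0 hd0] at h1; linarith
  set A := ∫⁻ x, (Metric.ball (0 : E) 1).indicator 1 x * ‖x‖ₑ ^ (-l) ∂μ with hA
  set B := ∫⁻ x, (Metric.ball (0 : E) 1)ᶜ.indicator 1 x * ‖x‖ₑ ^ (-(l * s')) ∂μ with hB
  have hAt : A < ∞ := lintegral_ball_enorm_rpow_lt_top μ hl
  have hBt : B < ∞ := lintegral_compl_ball_enorm_rpow_lt_top μ hls'
  refine ⟨A + B ^ (1 / s') + 1, ?_, ?_⟩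
  · have : B ^ (1 / s') < ∞ := ENNReal.rpow_lt_top_of_nonneg (by positivity) hBt.ne
    exact ENNReal.add_lt_top.mpr ⟨ENNReal.add_lt_top.mpr ⟨hAt, this⟩, ENNReal.one_lt_top⟩
  intro h hh hhs v y
  rcases eq_or_ne v 0 with rfl | hv0
  · simp
  rcases eq_or_ne v ∞ with rfl | hvt
  · rw [ENNReal.top_rpow_of_pos (by linarith), ENNReal.mul_top (by positivity)]; exact le_top
  lift v to NNReal using hvt
  have hv : 0 < (v : ℝ) := by
    have : (v : ℝ≥0∞) ≠ 0 := hv0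
    have h2 : v ≠ 0 := by exact_mod_cast this
    exact_mod_cast pos_iff_ne_zero.mpr h2
  set u : ℝ := (v : ℝ) with hu
  have hvu : (v : ℝ≥0∞) = ENNReal.ofReal u := by simp [hu]
  set R : ℝ := u ^ (-(p / d)) with hRdef
  have hR : 0 < R := by positivity
  -- At the radius `R = v ^ (-p / d)` both parts scale like `v ^ (p - 1)`.
  have hsplit : ∫⁻ x, {x | h x ^ s ≤ (v : ℝ≥0∞) ^ p}.indicator
      (fun x => h x * ‖x - y‖ₑ ^ (-l)) x ∂μ ≤
      (∫⁻ x, ENNReal.ofReal (u ^ (p / s)) *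
        ((Metric.ball (0 : E) 1).indicator 1 (R⁻¹ • (x - y)) * ‖x - y‖ₑ ^ (-l)) ∂μ) +
      ∫⁻ x, (h * fun x =>
        (Metric.ball (0 : E) 1)ᶜ.indicator 1 (R⁻¹ • (x - y)) * ‖x - y‖ₑ ^ (-l)) x ∂μ := by
    rw [← lintegral_add_left]
    · refine lintegral_mono fun x => ?_
      simp only [Pi.mul_apply]
      by_cases hx : h x ^ s ≤ (v : ℝ≥0∞) ^ p
      · rw [Set.indicator_of_mem (by exact hx)]
        have hx' : h x ≤ ENNReal.ofReal (u ^ (p / s)) := by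
          have := ENNReal.rpow_le_rpow hx (by positivity : 0 ≤ 1 / s)
          rw [← ENNReal.rpow_mul, ← ENNReal.rpow_mul, mul_one_div_cancel (by linarith),
            ENNReal.rpow_one, hvu, ENNReal.ofReal_rpow_of_pos hv, mul_one_div] at this
          exact this
        by_cases hb : R⁻¹ • (x - y) ∈ Metric.ball (0 : E) 1
        · rw [Set.indicator_of_mem hb, Set.indicator_of_notMem (by simpa using hb)]
          simp only [Pi.one_apply, one_mul, zero_mul, mul_zero, add_zero]
          gcongr
        · rw [Set.indicator_of_notMem hb, Set.indicator_of_mem (by simpa using hb)]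
          simp
      · rw [Set.indicator_of_notMem (by exact hx)]; exact zero_le
    · have : Measurable ((Metric.ball (0 : E) 1).indicator (1 : E → ℝ≥0∞)) :=
        measurable_one.indicator measurableSet_ball
      fun_prop
  have hnear : (∫⁻ x, ENNReal.ofReal (u ^ (p / s)) *
        ((Metric.ball (0 : E) 1).indicator 1 (R⁻¹ • (x - y)) * ‖x - y‖ₑ ^ (-l)) ∂μ)
        = ENNReal.ofReal (u ^ (p - 1)) * A := by
    rw [lintegral_const_mul' _ _ ENNReal.ofReal_ne_top,
      lintegral_sub_right_eq_self (fun x => (Metric.ball (0 : E) 1).indicator 1 (R⁻¹ • x) *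
        ‖x‖ₑ ^ (-l)) y, lintegral_mul_enorm_rpow_scale μ hR, ← mul_assoc,
        ← ENNReal.ofReal_mul (by positivity), hRdef, ← Real.rpow_mul hv.le, ← Real.rpow_add hv]
    congr 3
    have : p * (1 / p + 1 / s + l / d) = p * 2 := by rw [hps]
    field_simp at this ⊢
    linarith
  have hfar : ∫⁻ x, (h * fun x =>
        (Metric.ball (0 : E) 1)ᶜ.indicator 1 (R⁻¹ • (x - y)) * ‖x - y‖ₑ ^ (-l)) x ∂μ ≤
        ENNReal.ofReal (u ^ (p - 1)) * B ^ (1 / s') := by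
    refine (ENNReal.lintegral_mul_le_Lp_mul_Lq μ hss hh.aemeasurable ?_).trans ?_
    · have : Measurable ((Metric.ball (0 : E) 1)ᶜ.indicator (1 : E → ℝ≥0∞)) :=
        measurable_one.indicator measurableSet_ball.compl
      fun_prop
    have e1 : ∀ x : E, ((Metric.ball (0 : E) 1)ᶜ.indicator 1 (R⁻¹ • (x - y)) *
        ‖x - y‖ₑ ^ (-l)) ^ s' =
        (Metric.ball (0 : E) 1)ᶜ.indicator 1 (R⁻¹ • (x - y)) * ‖x - y‖ₑ ^ (-(l * s')) := by
      intro x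
      rw [ENNReal.mul_rpow_of_nonneg _ _ hs'0.le, ← ENNReal.rpow_mul, neg_mul]
      congr 1
      by_cases hb : R⁻¹ • (x - y) ∈ Metric.ball (0 : E) 1
      · rw [Set.indicator_of_notMem (by simpa using hb)]; simp [hs'0]
      · rw [Set.indicator_of_mem (by simpa using hb)]; simp
    simp_rw [e1]
    rw [lintegral_sub_right_eq_self (fun x => (Metric.ball (0 : E) 1)ᶜ.indicator 1 (R⁻¹ • x) *
        ‖x‖ₑ ^ (-(l * s'))) y, lintegral_mul_enorm_rpow_scale μ hR,
        ENNReal.mul_rpow_of_nonneg _ _ (by positivity), ← mul_assoc]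
    refine mul_le_mul_left ?_ _
    calc _ ≤ 1 * ENNReal.ofReal (R ^ ((Module.finrank ℝ E : ℝ) - l * s')) ^ (1 / s') := by
          gcongr
          exact ENNReal.rpow_le_one hhs (by positivity)
      _ = _ := by
          rw [one_mul, ENNReal.ofReal_rpow_of_pos (by positivity), hRdef, ← Real.rpow_mul hv.le,
            ← Real.rpow_mul hv.le]
          congr 2
          have e2 : (d - l * s') * (1 / s') = d * (1 - 1 / s) - l := by
            rw [sub_mul, hs'inv.symm]; field_simp
          rw [mul_assoc, ← hd, e2]
          have : p * (1 / p + 1 / s + l / d) = p * 2 := by rw [hps]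
          field_simp at this ⊢
          linarith
  calc _ ≤ (v : ℝ≥0∞) * (ENNReal.ofReal (u ^ (p - 1)) * A
        + ENNReal.ofReal (u ^ (p - 1)) * B ^ (1 / s')) := by
        gcongr; exact hsplit.trans (add_le_add hnear.le hfar)
    _ = (A + B ^ (1 / s')) * ((v : ℝ≥0∞) * ENNReal.ofReal (u ^ (p - 1))) := by ring
    _ = (A + B ^ (1 / s')) * (v : ℝ≥0∞) ^ p := by
        congr 1
        rw [hvu, ← ENNReal.ofReal_mul hv.le, ENNReal.ofReal_rpow_of_pos hv]
        congr 1
        nth_rw 1 [← Real.rpow_one u]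
        rw [← Real.rpow_add hv]; congr 1; ring
    _ ≤ _ := mul_le_mul_left le_self_add _

/-- The dual form of the Hardy–Littlewood–Sobolev inequality. The product space is split according
to which of `h x ^ s` and `f y ^ p` is larger, and the smaller function is integrated first. -/
theorem lintegral_lintegral_mul_potential_mul_le [Nontrivial E] {l p s : ℝ} (hp : 1 < p)
    (hs : 1 < s) (hl : l < Module.finrank ℝ E) (hl0 : 0 < l)
    (hps : 1 / p + 1 / s + l / Module.finrank ℝ E = 2) :
    ∃ C : ℝ≥0∞, C < ∞ ∧ ∀ f h : E → ℝ≥0∞, Measurable f → Measurable h →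
      ∫⁻ x, f x ^ p ∂μ ≤ 1 → ∫⁻ x, h x ^ s ∂μ ≤ 1 →
        ∫⁻ x, ∫⁻ y, h x * ‖x - y‖ₑ ^ (-l) * f y ∂μ ∂μ ≤ C := by
  obtain ⟨C₁, hC₁, H₁⟩ := lintegral_superlevel_mul_potential_le μ hp hs hl hl0 hps
  obtain ⟨C₂, hC₂, H₂⟩ := lintegral_superlevel_mul_potential_le μ hs hp hl hl0
    (by linarith : 1 / s + 1 / p + l / Module.finrank ℝ E = 2)
  refine ⟨C₁ + C₂, ENNReal.add_lt_top.mpr ⟨hC₁, hC₂⟩, fun f h hf hh hfp hhs => ?_⟩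
  set S : Set (E × E) := {z | h z.1 ^ s ≤ f z.2 ^ p} with hS
  have hSm : MeasurableSet S := measurableSet_le (by fun_prop) (by fun_prop)
  set S' : Set (E × E) := {z | f z.2 ^ p ≤ h z.1 ^ s} with hS'
  have hSm' : MeasurableSet S' := measurableSet_le (by fun_prop) (by fun_prop)
  set F : E × E → ℝ≥0∞ := fun z => h z.1 * ‖z.1 - z.2‖ₑ ^ (-l) * f z.2 with hF
  have hFm : Measurable F := by fun_prop
  have hle : ∀ z, F z ≤ S.indicator F z + S'.indicator F z := by
    intro z
    rcases le_total (h z.1 ^ s) (f z.2 ^ p) with hz | hz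
    · rw [Set.indicator_of_mem (by exact hz : z ∈ S)]; exact le_self_add
    · rw [Set.indicator_of_mem (by exact hz : z ∈ S')]; exact le_add_self
  have hA : ∫⁻ x, ∫⁻ y, S.indicator F (x, y) ∂μ ∂μ ≤ C₁ := by
    rw [lintegral_lintegral_swap (f := fun x y => S.indicator F (x, y))
      (hFm.indicator hSm).aemeasurable]
    calc _ ≤ ∫⁻ y, C₁ * f y ^ p ∂μ := by
          refine lintegral_mono fun y => ?_
          refine le_trans (le_of_eq ?_) (H₁ h hh hhs (f y) y)
          rw [← lintegral_const_mul]
          · refine lintegral_congr fun x => ?_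
            by_cases hx : h x ^ s ≤ f y ^ p
            · rw [Set.indicator_of_mem (by exact hx), Set.indicator_of_mem (by exact hx)]
              simp only [hF]; ring
            · rw [Set.indicator_of_notMem (by exact hx), Set.indicator_of_notMem (by exact hx),
                mul_zero]
          · refine Measurable.indicator (by fun_prop) (measurableSet_le (by fun_prop) (by fun_prop))
      _ = C₁ * ∫⁻ y, f y ^ p ∂μ := lintegral_const_mul' _ _ hC₁.ne
      _ ≤ C₁ * 1 := by gcongr
      _ = C₁ := mul_one _
  have hB : ∫⁻ x, ∫⁻ y, S'.indicator F (x, y) ∂μ ∂μ ≤ C₂ := by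
    calc _ ≤ ∫⁻ x, C₂ * h x ^ s ∂μ := by
          refine lintegral_mono fun x => ?_
          refine le_trans (le_of_eq ?_) (H₂ f hf hfp (h x) x)
          rw [← lintegral_const_mul]
          · refine lintegral_congr fun y => ?_
            by_cases hx : f y ^ p ≤ h x ^ s
            · rw [Set.indicator_of_mem (by exact hx), Set.indicator_of_mem (by exact hx)]
              simp only [hF]
              rw [← enorm_neg, neg_sub]; ring
            · rw [Set.indicator_of_notMem (by exact hx), Set.indicator_of_notMem (by exact hx),
                mul_zero]
          · refine Measurable.indicator (by fun_prop) (measurableSet_le (by fun_prop) (by fun_prop))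
      _ = C₂ * ∫⁻ y, h y ^ s ∂μ := lintegral_const_mul' _ _ hC₂.ne
      _ ≤ C₂ * 1 := by gcongr
      _ = C₂ := mul_one _
  calc _ ≤ ∫⁻ x, ∫⁻ y, (S.indicator F (x, y) + S'.indicator F (x, y)) ∂μ ∂μ :=
        lintegral_mono fun x => lintegral_mono fun y => hle (x, y)
    _ = ∫⁻ x, ∫⁻ y, S.indicator F (x, y) ∂μ ∂μ + ∫⁻ x, ∫⁻ y, S'.indicator F (x, y) ∂μ ∂μ := by
        rw [← lintegral_add_left (hFm.indicator hSm).lintegral_prod_right']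
        refine lintegral_congr fun x => ?_
        rw [lintegral_add_left]
        exact (hFm.indicator hSm).comp measurable_prodMk_left
    _ ≤ _ := add_le_add hA hB

/-- The converse of Hölder's inequality, tested against truncations of `G ^ (q - 1)`. -/
theorem lintegral_rpow_le_of_forall_lintegral_mul_le {α : Type*} [MeasurableSpace α]
    (ν : Measure α) [SigmaFinite ν] {q : ℝ} (hq : 1 < q) {G : α → ℝ≥0∞}
    (hG : Measurable G) {C : ℝ≥0∞}
    (H : ∀ h : α → ℝ≥0∞, Measurable h → ∫⁻ x, h x ^ (q / (q - 1)) ∂ν ≤ 1 →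
      ∫⁻ x, h x * G x ∂ν ≤ C) :
    ∫⁻ x, G x ^ q ∂ν ≤ C ^ q := by
  have hq0 : 0 < q := by linarith
  have hq1 : 0 < q - 1 := by linarith
  set G' : ℕ → α → ℝ≥0∞ := fun N => (spanningSets ν N).indicator fun x => min (G x) N with hG'
  have hG'm : ∀ N, Measurable (G' N) := fun N =>
    (hG.min measurable_const).indicator (measurableSet_spanningSets ν N)
  have hG'le : ∀ N x, G' N x ≤ G x := fun N x =>
    (Set.indicator_le_self _ _ x).trans (min_le_left _ _)
  have hlim : ∀ x, Filter.Tendsto (fun N => G' N x ^ q) Filter.atTop (nhds (G x ^ q)) := by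
    intro x
    refine (ENNReal.continuous_rpow_const.tendsto _).comp ?_
    have h1 : Filter.Tendsto (fun N : ℕ => min (G x) (N : ℝ≥0∞)) Filter.atTop
        (nhds (min (G x) ∞)) := tendsto_const_nhds.min ENNReal.tendsto_nat_nhds_top
    rw [min_eq_left le_top] at h1
    refine h1.congr' ?_
    filter_upwards [eventually_mem_spanningSets ν x] with N hN
    simp only [hG', Set.indicator_of_mem hN]
  have hbound : ∀ N, ∫⁻ x, G' N x ^ q ∂ν ≤ C ^ q := by
    intro N
    -- The truncation makes `W` finite, so that the test function `W ^ (-(q - 1) / q) G' ^ (q - 1)`,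
    -- of unit norm, is available.
    set W := ∫⁻ x, G' N x ^ q ∂ν with hW
    have hWt : W ≠ ∞ := by
      refine ne_top_of_le_ne_top (b := (N : ℝ≥0∞) ^ q * ν (spanningSets ν N)) ?_ ?_
      · exact ENNReal.mul_ne_top (ENNReal.rpow_ne_top_of_nonneg hq0.le (ENNReal.natCast_ne_top N))
          (measure_spanningSets_lt_top ν N).ne
      · rw [← setLIntegral_const, ← lintegral_indicator (measurableSet_spanningSets ν N)]
        refine lintegral_mono fun x => ?_
        by_cases hx : x ∈ spanningSets ν N
        · simp only [hG', Set.indicator_of_mem hx]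
          exact ENNReal.rpow_le_rpow (min_le_right _ _) hq0.le
        · simp [hG', Set.indicator_of_notMem hx, hq0]
    rcases eq_or_ne W 0 with h0 | h0
    · rw [h0]; exact zero_le
    have h1 := H (fun x => W ^ (-((q - 1) / q)) * G' N x ^ (q - 1)) (by fun_prop) ?_
    · have h2 : W ^ (1 / q) ≤ C := by
        refine le_trans ?_ h1
        calc W ^ (1 / q) = W ^ (-((q - 1) / q)) * W := by
              nth_rw 3 [← ENNReal.rpow_one W]
              rw [← ENNReal.rpow_add _ _ h0 hWt]; congr 1; field_simp; ring
          _ = ∫⁻ x, W ^ (-((q - 1) / q)) * G' N x ^ q ∂ν :=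
              (lintegral_const_mul _ (by fun_prop)).symm
          _ ≤ _ := by
              refine lintegral_mono fun x => ?_
              rw [mul_assoc]
              gcongr
              calc G' N x ^ q = G' N x ^ (q - 1) * G' N x := by
                    nth_rw 3 [← ENNReal.rpow_one (G' N x)]
                    rw [← ENNReal.rpow_add_of_nonneg _ _ hq1.le zero_le_one]; congr 1; ring
                _ ≤ _ := by gcongr; exact hG'le N x
      calc W = (W ^ (1 / q)) ^ q := by rw [← ENNReal.rpow_mul, one_div_mul_cancel hq0.ne',
              ENNReal.rpow_one]
        _ ≤ C ^ q := ENNReal.rpow_le_rpow h2 hq0.le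
    · simp_rw [ENNReal.mul_rpow_of_nonneg _ _ (div_pos hq0 hq1).le, ← ENNReal.rpow_mul]
      rw [mul_div_cancel₀ _ hq1.ne', lintegral_const_mul _ (by fun_prop), ← hW]
      have : -((q - 1) / q) * (q / (q - 1)) = -1 := by field_simp
      rw [this, ENNReal.rpow_neg_one, ENNReal.inv_mul_cancel h0 hWt]
  calc ∫⁻ x, G x ^ q ∂ν = ∫⁻ x, Filter.liminf (fun N => G' N x ^ q) Filter.atTop ∂ν :=
        lintegral_congr fun x => (hlim x).liminf_eq.symm
    _ ≤ Filter.liminf (fun N => ∫⁻ x, G' N x ^ q ∂ν) Filter.atTop :=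
        lintegral_liminf_le fun N => (hG'm N).pow_const q
    _ ≤ C ^ q := by
        refine Filter.liminf_le_of_le (by isBoundedDefault) fun b hb => ?_
        obtain ⟨N, hN⟩ := hb.exists
        exact hN.trans (hbound N)

/-- The Hardy–Littlewood–Sobolev inequality. -/
theorem lintegral_potential_rpow_le [Nontrivial E] {l p q : ℝ} (hp : 1 < p) (hq : 1 < q)
    (hl : l < Module.finrank ℝ E) (hl0 : 0 < l)
    (hpq : 1 / p - 1 / q + l / Module.finrank ℝ E = 1) :
    ∃ C : ℝ≥0∞, C < ∞ ∧ ∀ f : E → ℝ≥0∞, Measurable f → ∫⁻ x, f x ^ p ∂μ ≤ 1 →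
      ∫⁻ x, (∫⁻ y, ‖y‖ₑ ^ (-l) * f (x - y) ∂μ) ^ q ∂μ ≤ C ^ q := by
  have hs : 1 < q / (q - 1) := by rw [lt_div_iff₀ (by linarith)]; linarith
  have hs' : 1 / (q / (q - 1)) = 1 - 1 / q := by
    rw [one_div_div, sub_div, div_self (by linarith)]
  obtain ⟨C, hC, H⟩ := lintegral_lintegral_mul_potential_mul_le μ hp hs hl hl0
    (by rw [hs']; linarith)
  refine ⟨C, hC, fun f hf hfp => ?_⟩
  refine lintegral_rpow_le_of_forall_lintegral_mul_le μ hq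
    (Measurable.lintegral_prod_right' (f := fun z : E × E => ‖z.2‖ₑ ^ (-l) * f (z.1 - z.2))
      (by fun_prop)) fun h hh hhs => ?_
  refine le_trans (le_of_eq (lintegral_congr fun x => ?_)) (H f h hf hh hfp hhs)
  rw [← lintegral_sub_left_eq_self _ x, ← lintegral_const_mul _ (by fun_prop)]
  refine lintegral_congr fun y => ?_
  rw [sub_sub_cancel, mul_assoc]

/-- Jensen's inequality for the measure with density `g`. -/
theorem lintegral_mul_rpow_le {α : Type*} [MeasurableSpace α] (ν : Measure α) {p : ℝ}
    (hp : 1 ≤ p) {g f : α → ℝ≥0∞} (hg : Measurable g) (hf : Measurable f) :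
    (∫⁻ x, g x * f x ∂ν) ^ p ≤ (∫⁻ x, g x ∂ν) ^ (p - 1) * ∫⁻ x, g x * f x ^ p ∂ν := by
  have hp0 : 0 < p := by linarith
  have h := ENNReal.lintegral_mul_norm_pow_le (μ := ν) (f := g) (g := fun x => g x * f x ^ p)
    hg.aemeasurable (by fun_prop) (p := (p - 1) / p) (q := 1 / p)
    (div_nonneg (by linarith) hp0.le) (by positivity) (by field_simp; ring)
  have e : ∀ x, g x ^ ((p - 1) / p) * (g x * f x ^ p) ^ (1 / p) = g x * f x := by
    intro x
    rw [ENNReal.mul_rpow_of_nonneg _ _ (by positivity), ← ENNReal.rpow_mul,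
      mul_one_div_cancel hp0.ne', ENNReal.rpow_one, ← mul_assoc,
      ← ENNReal.rpow_add_of_nonneg _ _ (div_nonneg (by linarith) hp0.le) (by positivity),
      ← add_div, sub_add_cancel, div_self hp0.ne', ENNReal.rpow_one]
  simp_rw [e] at h
  refine (ENNReal.rpow_le_rpow h hp0.le).trans (le_of_eq ?_)
  rw [ENNReal.mul_rpow_of_nonneg _ _ hp0.le, ← ENNReal.rpow_mul, ← ENNReal.rpow_mul,
    one_div_mul_cancel hp0.ne', ENNReal.rpow_one, div_mul_cancel₀ _ hp0.ne']

/-- A form of Young's convolution inequality: the bound is the interpolation between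
`L^p → L^p` and `L^p → L^∞`. -/
theorem eLpNorm_lconvolution_le {p q : ℝ≥0∞} (hp : 1 ≤ p) (hpq : p ≤ q) {g : E → ℝ≥0∞}
    (hg : Measurable g) {I B : ℝ≥0∞} (hI : ∫⁻ x, g x ∂μ ≤ I) (hB : ∀ x, g x ≤ B)
    {f : E → ℝ≥0∞} (hf : Measurable f) (hf1 : eLpNorm f p μ ≤ 1) :
    eLpNorm (fun x => ∫⁻ y, g y * f (x - y) ∂μ) q μ ≤
      I ^ (1 - ((1 / p).toReal - (1 / q).toReal)) * B ^ ((1 / p).toReal - (1 / q).toReal) := by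
  have e0 : (fun x => ∫⁻ y, g y * f (x - y) ∂μ) = fun x => ∫⁻ y, g (x - y) * f y ∂μ := by
    funext x
    rw [← lintegral_sub_left_eq_self _ x]
    simp only [sub_sub_cancel]
  rw [e0]
  have hI' : ∀ x, ∫⁻ y, g (x - y) ∂μ ≤ I := fun x => by
    rw [lintegral_sub_left_eq_self]; exact hI
  rcases eq_or_ne p ∞ with rfl | hpt
  · obtain rfl : q = ∞ := top_le_iff.mp hpq
    simp only [ENNReal.div_top, ENNReal.toReal_zero, sub_self, sub_zero, ENNReal.rpow_one,
      ENNReal.rpow_zero, mul_one]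
    rw [eLpNorm_exponent_top] at hf1 ⊢
    refine eLpNormEssSup_le_of_ae_enorm_bound (Filter.Eventually.of_forall fun x => ?_)
    rw [enorm_eq_self]
    have hae : ∀ᵐ y ∂μ, f y ≤ 1 := by
      filter_upwards [ae_le_eLpNormEssSup (f := f) (μ := μ)] with y hy
      exact hy.trans hf1
    refine le_trans (lintegral_mono_ae ?_) (hI' x)
    filter_upwards [hae] with y hy
    exact mul_le_of_le_one_right' hy
  have hp0 : p ≠ 0 := (zero_lt_one.trans_le hp).ne'
  set P := p.toReal with hP
  have hP1 : 1 ≤ P := by rw [hP, ← ENNReal.toReal_one]; exact ENNReal.toReal_mono hpt hp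
  have hP0 : 0 < P := by linarith
  have hinvP : (1 / p).toReal = 1 / P := by simp [hP]
  have hfP : ∫⁻ y, f y ^ P ∂μ ≤ 1 := by
    rw [eLpNorm_eq_lintegral_rpow_enorm_toReal hp0 hpt] at hf1
    simp only [enorm_eq_self] at hf1
    have := ENNReal.rpow_le_rpow hf1 hP0.le
    rwa [← ENNReal.rpow_mul, one_div_mul_cancel hP0.ne', ENNReal.rpow_one, ENNReal.one_rpow] at this
  have hJ : ∀ x, (∫⁻ y, g (x - y) * f y ∂μ) ^ P ≤
      I ^ (P - 1) * ∫⁻ y, g (x - y) * f y ^ P ∂μ := fun x => by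
    refine (lintegral_mul_rpow_le μ hP1 (by fun_prop) hf).trans ?_
    exact mul_le_mul_left (ENNReal.rpow_le_rpow (hI' x) (by linarith)) _
  have hsup : ∀ x, (∫⁻ y, g (x - y) * f y ∂μ) ^ P ≤ I ^ (P - 1) * B := fun x => by
    refine (hJ x).trans ?_
    gcongr
    calc _ ≤ ∫⁻ y, B * f y ^ P ∂μ := by gcongr; exact hB _
      _ = B * ∫⁻ y, f y ^ P ∂μ := lintegral_const_mul _ (by fun_prop)
      _ ≤ B * 1 := by gcongr
      _ = B := mul_one _
  rcases eq_or_ne q ∞ with rfl | hqt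
  · rw [eLpNorm_exponent_top]
    refine eLpNormEssSup_le_of_ae_enorm_bound (Filter.Eventually.of_forall fun x => ?_)
    rw [enorm_eq_self, hinvP, ENNReal.div_top, ENNReal.toReal_zero, sub_zero]
    have := ENNReal.rpow_le_rpow (hsup x) (by positivity : 0 ≤ 1 / P)
    rw [← ENNReal.rpow_mul, mul_one_div_cancel hP0.ne', ENNReal.rpow_one,
      ENNReal.mul_rpow_of_nonneg _ _ (by positivity), ← ENNReal.rpow_mul, sub_mul,
      mul_one_div_cancel hP0.ne', one_mul] at this
    exact this
  have hq0 : q ≠ 0 := (zero_lt_one.trans_le (hp.trans hpq)).ne'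
  set Q := q.toReal with hQ
  have hPQ : P ≤ Q := ENNReal.toReal_mono hqt hpq
  have hQ0 : 0 < Q := by linarith
  have hinvQ : (1 / q).toReal = 1 / Q := by simp [hQ]
  rw [eLpNorm_eq_lintegral_rpow_enorm_toReal hq0 hqt, hinvP, hinvQ, ← hQ]
  simp only [enorm_eq_self]
  have hmain : ∫⁻ x, (∫⁻ y, g (x - y) * f y ∂μ) ^ Q ∂μ ≤
      (I ^ (P - 1) * B) ^ ((Q - P) / P) * I ^ P := by
    calc _ ≤ ∫⁻ x, ((I ^ (P - 1) * B) ^ ((Q - P) / P) * I ^ (P - 1)) *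
            ∫⁻ y, g (x - y) * f y ^ P ∂μ ∂μ := by
          refine lintegral_mono fun x => ?_
          have : (∫⁻ y, g (x - y) * f y ∂μ) ^ Q = ((∫⁻ y, g (x - y) * f y ∂μ) ^ P) ^ ((Q - P) / P)
              * (∫⁻ y, g (x - y) * f y ∂μ) ^ P := by
            rw [← ENNReal.rpow_mul, ← ENNReal.rpow_add_of_nonneg _ _ _ hP0.le]
            · congr 1; field_simp; ring
            · exact mul_nonneg hP0.le (div_nonneg (by linarith) hP0.le)
          rw [this, mul_assoc]
          have h3 : 0 ≤ (Q - P) / P := div_nonneg (by linarith) hP0.le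
          gcongr
          · exact hsup x
          · exact hJ x
      _ = ((I ^ (P - 1) * B) ^ ((Q - P) / P) * I ^ (P - 1)) *
            ∫⁻ x, ∫⁻ y, g (x - y) * f y ^ P ∂μ ∂μ := by
          rw [lintegral_const_mul]
          exact Measurable.lintegral_prod_right' (f := fun z : E × E => g (z.1 - z.2) * f z.2 ^ P)
            (by fun_prop)
      _ ≤ ((I ^ (P - 1) * B) ^ ((Q - P) / P) * I ^ (P - 1)) * I := by
          gcongr
          rw [lintegral_lintegral_swap (by fun_prop)]
          calc _ = ∫⁻ y, (∫⁻ x, g x ∂μ) * f y ^ P ∂μ := by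
                refine lintegral_congr fun y => ?_
                rw [lintegral_mul_const _ (by fun_prop), lintegral_sub_right_eq_self]
            _ = (∫⁻ x, g x ∂μ) * ∫⁻ y, f y ^ P ∂μ := lintegral_const_mul _ (by fun_prop)
            _ ≤ I * 1 := by gcongr
            _ = I := mul_one _
      _ = _ := by
          rw [mul_assoc]
          congr 1
          nth_rw 2 [← ENNReal.rpow_one I]
          rw [← ENNReal.rpow_add_of_nonneg _ _ (by linarith) zero_le_one, sub_add_cancel]
  refine (ENNReal.rpow_le_rpow hmain (by positivity)).trans (le_of_eq ?_)
  have h3 : 0 ≤ (Q - P) / P := div_nonneg (by linarith) hP0.le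
  rw [ENNReal.mul_rpow_of_nonneg _ _ (by positivity), ENNReal.mul_rpow_of_nonneg _ _ h3,
    ENNReal.mul_rpow_of_nonneg _ _ (by positivity), ← ENNReal.rpow_mul, ← ENNReal.rpow_mul,
    ← ENNReal.rpow_mul, ← ENNReal.rpow_mul, mul_right_comm, ← ENNReal.rpow_add_of_nonneg _ _
      (mul_nonneg (by linarith) (mul_nonneg h3 (by positivity))) (by positivity)]
  congr 2 <;> field_simp <;> ring

end PotentialKernel

/-! ### Families of functions with uniformly bounded derivatives at given points -/

section Jets

variable {ι : Type*} {E F G : Type*} [NormedAddCommGroup E] [NormedSpace ℝ E]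
  [NormedAddCommGroup F] [NormedSpace ℝ F] [NormedAddCommGroup G] [NormedSpace ℝ G]

/-- A family of functions `f i` is `N` times continuously differentiable at the points `x i`, with
derivatives of order at most `N` at these points bounded uniformly in `i`. -/
def BddJets (N : ℕ) (f : ι → E → F) (x : ι → E) : Prop :=
  ∃ A : ℝ, ∀ i, ContDiffAt ℝ N (f i) (x i) ∧ ∀ k ≤ N, ‖iteratedFDeriv ℝ k (f i) (x i)‖ ≤ A

variable {N : ℕ} {x : ι → E}

theorem ContDiffAt.exists_isOpen_contDiffOn {f : E → F} {y : E} (hf : ContDiffAt ℝ N f y) :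
    ∃ u : Set E, IsOpen u ∧ y ∈ u ∧ ContDiffOn ℝ N f u := by
  obtain ⟨u, hu, hfu⟩ := hf.contDiffOn le_rfl (by simp)
  obtain ⟨v, hvu, hv, hy⟩ := mem_nhds_iff.mp hu
  exact ⟨v, hv, hy, hfu.mono hvu⟩

theorem norm_iteratedFDeriv_mul_le_of_contDiffAt {f g : E → ℝ} {y : E} (hf : ContDiffAt ℝ N f y)
    (hg : ContDiffAt ℝ N g y) {k : ℕ} (hk : k ≤ N) :
    ‖iteratedFDeriv ℝ k (fun z => f z * g z) y‖ ≤
      ∑ i ∈ Finset.range (k + 1), (k.choose i : ℝ) * ‖iteratedFDeriv ℝ i f y‖ *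
        ‖iteratedFDeriv ℝ (k - i) g y‖ := by
  obtain ⟨u, hu, hyu, hfu⟩ := hf.exists_isOpen_contDiffOn
  obtain ⟨v, hv, hyv, hgv⟩ := hg.exists_isOpen_contDiffOn
  have h := norm_iteratedFDerivWithin_mul_le (hfu.mono (Set.inter_subset_left (t := v)))
    (hgv.mono (Set.inter_subset_right (s := u))) (hu.inter hv).uniqueDiffOn ⟨hyu, hyv⟩
    (n := k) (by exact_mod_cast hk)
  simpa only [iteratedFDerivWithin_of_isOpen _ (hu.inter hv) ⟨hyu, hyv⟩] using h

theorem norm_iteratedFDeriv_comp_le_of_contDiffAt {g : F → G} {f : E → F} {y : E}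
    (hg : ContDiffAt ℝ N g (f y)) (hf : ContDiffAt ℝ N f y) {k : ℕ} (hk : k ≤ N) {C D : ℝ}
    (hC : ∀ i ≤ k, ‖iteratedFDeriv ℝ i g (f y)‖ ≤ C)
    (hD : ∀ i, 1 ≤ i → i ≤ k → ‖iteratedFDeriv ℝ i f y‖ ≤ D ^ i) :
    ‖iteratedFDeriv ℝ k (g ∘ f) y‖ ≤ k.factorial * C * D ^ k := by
  obtain ⟨v, hv, hyv, hgv⟩ := hg.exists_isOpen_contDiffOn
  obtain ⟨u, hu, hyu, hfu⟩ := hf.exists_isOpen_contDiffOn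
  obtain ⟨w, hw, hwo, hyw⟩ := mem_nhds_iff.mp
    (Filter.inter_mem (hu.mem_nhds hyu) (hf.continuousAt.preimage_mem_nhds (hv.mem_nhds hyv)))
  have h := norm_iteratedFDerivWithin_comp_le (N := N) (n := k) hgv
    (hfu.mono fun z hz => (hw hz).1) (by exact_mod_cast hk) hv.uniqueDiffOn hwo.uniqueDiffOn
    (fun z hz => (hw hz).2) hyw (C := C) (D := D)
    (fun i hi => by rw [iteratedFDerivWithin_of_isOpen _ hv hyv]; exact hC i hi)
    (fun i hi hik => by rw [iteratedFDerivWithin_of_isOpen _ hwo hyw]; exact hD i hi hik)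
  rwa [iteratedFDerivWithin_of_isOpen _ hwo hyw] at h

theorem BddJets.exists_nonneg {f : ι → E → F} (hf : BddJets N f x) : ∃ A : ℝ, 0 ≤ A ∧ ∀ i,
    ContDiffAt ℝ N (f i) (x i) ∧ ∀ k ≤ N, ‖iteratedFDeriv ℝ k (f i) (x i)‖ ≤ A := by
  obtain ⟨A, hA⟩ := hf
  exact ⟨|A|, abs_nonneg _, fun i => ⟨(hA i).1, fun k hk => ((hA i).2 k hk).trans (le_abs_self A)⟩⟩

theorem BddJets.contDiffAt {f : ι → E → F} (hf : BddJets N f x) (i : ι) :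
    ContDiffAt ℝ N (f i) (x i) := by
  obtain ⟨A, hA⟩ := hf
  exact (hA i).1

theorem BddJets.exists_norm_le {f : ι → E → F} (hf : BddJets N f x) :
    ∃ A : ℝ, ∀ i, ‖f i (x i)‖ ≤ A := by
  obtain ⟨A, hA⟩ := hf
  refine ⟨A, fun i => ?_⟩
  simpa using (hA i).2 0 (Nat.zero_le _)

theorem BddJets.comp_index {κ : Type*} {f : ι → E → F} (hf : BddJets N f x) (e : κ → ι) :
    BddJets N (fun i => f (e i)) (fun i => x (e i)) := by
  obtain ⟨A, hA⟩ := hf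
  exact ⟨A, fun i => hA (e i)⟩

theorem BddJets.add {f g : ι → E → F} (hf : BddJets N f x) (hg : BddJets N g x) :
    BddJets N (fun i z => f i z + g i z) x := by
  obtain ⟨A, hA⟩ := hf
  obtain ⟨B, hB⟩ := hg
  refine ⟨A + B, fun i => ⟨(hA i).1.add (hB i).1, fun k hk => ?_⟩⟩
  have hk' : (k : WithTop ℕ∞) ≤ N := by exact_mod_cast hk
  rw [fun_iteratedFDeriv_add_apply ((hA i).1.of_le hk') ((hB i).1.of_le hk')]
  exact (norm_add_le _ _).trans (add_le_add ((hA i).2 k hk) ((hB i).2 k hk))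

theorem BddJets.mul {f g : ι → E → ℝ} (hf : BddJets N f x) (hg : BddJets N g x) :
    BddJets N (fun i z => f i z * g i z) x := by
  obtain ⟨A, hA0, hA⟩ := hf.exists_nonneg
  obtain ⟨B, hB0, hB⟩ := hg.exists_nonneg
  refine ⟨2 ^ N * (A * B), fun i => ⟨(hA i).1.mul (hB i).1, fun k hk => ?_⟩⟩
  refine (norm_iteratedFDeriv_mul_le_of_contDiffAt (hA i).1 (hB i).1 hk).trans ?_
  calc _ ≤ ∑ j ∈ Finset.range (k + 1), (k.choose j : ℝ) * (A * B) := by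
        refine Finset.sum_le_sum fun j hj => ?_
        have hj' : j ≤ k := by simpa [Nat.lt_succ_iff] using hj
        rw [mul_assoc]
        gcongr
        · exact (hA i).2 j (by omega)
        · exact (hB i).2 (k - j) (by omega)
    _ = 2 ^ k * (A * B) := by
        rw [← Finset.sum_mul]
        congr 1
        exact_mod_cast Nat.sum_range_choose k
    _ ≤ 2 ^ N * (A * B) := by
        gcongr
        norm_num

theorem BddJets.of_const {c : ι → F} (hc : ∃ A, ∀ i, ‖c i‖ ≤ A) :
    BddJets N (fun i (_ : E) => c i) x := by
  obtain ⟨A, hA⟩ := hc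
  refine ⟨A, fun i => ⟨contDiffAt_const, fun k _ => ?_⟩⟩
  rcases Nat.eq_zero_or_pos k with rfl | hk
  · simpa using hA i
  · rw [iteratedFDeriv_const_of_ne hk.ne']
    simpa using (norm_nonneg _).trans (hA i)

theorem BddJets.comp {f : ι → E → F} {g : ι → F → G} (hg : BddJets N g fun i => f i (x i))
    (hf : BddJets N f x) : BddJets N (fun i => g i ∘ f i) x := by
  obtain ⟨A, hA0, hA⟩ := hf.exists_nonneg
  obtain ⟨B, hB0, hB⟩ := hg.exists_nonneg
  refine ⟨N.factorial * B * (max A 1) ^ N, fun i => ⟨(hB i).1.comp _ (hA i).1, fun k hk => ?_⟩⟩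
  refine (norm_iteratedFDeriv_comp_le_of_contDiffAt (hB i).1 (hA i).1 hk (C := B) (D := max A 1)
    (fun j hj => (hB i).2 j (hj.trans hk)) fun j hj hjk => ?_).trans ?_
  · exact ((hA i).2 j (hjk.trans hk)).trans
      ((le_max_left _ _).trans (le_self_pow₀ (le_max_right _ _) (by omega)))
  · gcongr
    exact le_max_right _ _

/-- A smooth function on an open set, taken at points of a compact subset. -/
theorem BddJets.of_contDiffOn {g : F → G} {U K : Set F} (hU : IsOpen U) (hK : IsCompact K)
    (hKU : K ⊆ U) (hg : ContDiffOn ℝ N g U) {y : ι → F} (hy : ∀ i, y i ∈ K) :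
    BddJets N (fun _ : ι => g) y := by
  have h : ∀ k ≤ N, ∃ A, ∀ z ∈ K, ‖iteratedFDeriv ℝ k g z‖ ≤ A := fun k hk => by
    have hc := hg.continuousOn_iteratedFDerivWithin (m := k) (by exact_mod_cast hk)
      hU.uniqueDiffOn
    obtain ⟨A, hA⟩ := hK.exists_bound_of_continuousOn (hc.mono hKU)
    refine ⟨A, fun z hz => ?_⟩
    rw [← iteratedFDerivWithin_of_isOpen _ hU (hKU hz)]
    exact hA z hz
  choose! A hA using h
  refine ⟨∑ k ∈ Finset.range (N + 1), |A k|, fun i =>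
    ⟨hg.contDiffAt (hU.mem_nhds (hKU (hy i))), fun k hk => (hA k hk _ (hy i)).trans ?_⟩⟩
  exact (le_abs_self _).trans (Finset.single_le_sum (f := fun k => |A k|)
    (fun _ _ => abs_nonneg _) (Finset.mem_range.mpr (by omega)))

theorem BddJets.congr {f g : ι → E → F} (hf : BddJets N f x)
    (h : ∀ i, f i =ᶠ[nhds (x i)] g i) : BddJets N g x := by
  obtain ⟨A, hA⟩ := hf
  refine ⟨A, fun i => ⟨(hA i).1.congr_of_eventuallyEq (h i).symm, fun k hk => ?_⟩⟩
  rw [← (h i).iteratedFDeriv ℝ k |>.eq_of_nhds]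
  exact (hA i).2 k hk

/-- The functions `y ↦ exp (τ y)`, normalized by `exp (c τ)`, at points `y ≤ - 2 c`: half of the
decay absorbs the powers of `τ` that differentiation produces, uniformly in `τ ≥ 0`. -/
theorem BddJets.exp_mul {τ : ι → ℝ} (hτ : ∀ i, 0 ≤ τ i) {c : ℝ} (hc : 0 < c) {y : ι → ℝ}
    (hy : ∀ i, y i ≤ -(2 * c)) :
    BddJets N (fun i z => Real.exp (c * τ i) * Real.exp (τ i * z)) y := by
  refine ⟨N.factorial * (max c⁻¹ 1) ^ N, fun i => ⟨by fun_prop, fun k hk => ?_⟩⟩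
  have h1 : iteratedFDeriv ℝ k (fun z => Real.exp (c * τ i) * Real.exp (τ i * z)) (y i)
      = Real.exp (c * τ i) • iteratedFDeriv ℝ k (fun z => Real.exp (τ i * z)) (y i) :=
    iteratedFDeriv_const_smul_apply (a := Real.exp (c * τ i)) (f := fun z => Real.exp (τ i * z))
      (by fun_prop)
  rw [h1, norm_smul, norm_iteratedFDeriv_eq_norm_iteratedDeriv, iteratedDeriv_exp_const_mul,
    norm_mul, norm_pow, Real.norm_of_nonneg (hτ i), Real.norm_of_nonneg (Real.exp_pos _).le,
    Real.norm_of_nonneg (Real.exp_pos _).le]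
  have h2 : (c * τ i) ^ k / k.factorial ≤ Real.exp (c * τ i) :=
    Real.pow_div_factorial_le_exp _ (mul_nonneg hc.le (hτ i)) k
  have h3 : Real.exp (τ i * y i) ≤ Real.exp (-(2 * (c * τ i))) := by
    refine Real.exp_le_exp.mpr ?_
    nlinarith [mul_le_mul_of_nonneg_left (hy i) (hτ i)]
  have h4 : τ i ^ k ≤ k.factorial * c⁻¹ ^ k * Real.exp (c * τ i) := by
    rw [div_le_iff₀ (by positivity)] at h2
    calc τ i ^ k = c⁻¹ ^ k * (c * τ i) ^ k := by
          rw [mul_pow, ← mul_assoc, ← mul_pow, inv_mul_cancel₀ hc.ne', one_pow, one_mul]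
      _ ≤ c⁻¹ ^ k * (Real.exp (c * τ i) * k.factorial) := by gcongr
      _ = _ := by ring
  calc _ ≤ Real.exp (c * τ i) * ((k.factorial * c⁻¹ ^ k * Real.exp (c * τ i)) *
        Real.exp (-(2 * (c * τ i)))) := by gcongr
    _ = k.factorial * c⁻¹ ^ k *
        (Real.exp (c * τ i) * Real.exp (c * τ i) * Real.exp (-(2 * (c * τ i)))) := by ring
    _ = k.factorial * c⁻¹ ^ k := by
        rw [← Real.exp_add, ← Real.exp_add]
        ring_nf
        simp
    _ ≤ k.factorial * (max c⁻¹ 1) ^ k := by gcongr; exact le_max_left _ _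
    _ ≤ N.factorial * (max c⁻¹ 1) ^ N := by
        gcongr
        exact le_max_right _ _

end Jets

/-! ### The rescaled multiplier -/

section Symbol

theorem norm_iteratedFDeriv_le_of_partialDeriv {n k : ℕ} {f : EuclideanSpace ℝ (Fin n) → ℝ}
    {ξ : EuclideanSpace ℝ (Fin n)} {B : ℝ} (h : ∀ γ : Fin k → Fin n, |partialDeriv γ f ξ| ≤ B) :
    ‖iteratedFDeriv ℝ k f ξ‖ ≤ n ^ k * |B| := by
  refine ContinuousMultilinearMap.opNorm_le_bound (by positivity) fun m => ?_
  have hm : m = fun j => ∑ i, m j i • EuclideanSpace.single i (1 : ℝ) := by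
    funext j
    ext l
    simp [Finset.sum_apply, Pi.single_apply]
  have h1 : iteratedFDeriv ℝ k f ξ m =
      ∑ γ : Fin k → Fin n, (∏ j, m j (γ j)) * partialDeriv γ f ξ := by
    conv_lhs => rw [hm]
    rw [ContinuousMultilinearMap.map_sum]
    refine Finset.sum_congr rfl fun γ _ => ?_
    rw [ContinuousMultilinearMap.map_smul_univ, smul_eq_mul, partialDeriv]
  rw [h1]
  calc _ ≤ ∑ γ : Fin k → Fin n, (∏ j, ‖m j‖) * |B| := by
        refine (norm_sum_le _ _).trans (Finset.sum_le_sum fun γ _ => ?_)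
        rw [norm_mul, norm_prod]
        gcongr
        · exact PiLp.norm_apply_le _ _
        · exact (h γ).trans (le_abs_self B)
    _ = _ := by
        rw [Finset.sum_const, Finset.card_univ, Fintype.card_fun, Fintype.card_fin,
          Fintype.card_fin, nsmul_eq_mul]
        push_cast
        ring

theorem norm_iteratedFDeriv_comp_smul_le {E F : Type*} [NormedAddCommGroup E] [NormedSpace ℝ E]
    [NormedAddCommGroup F] [NormedSpace ℝ F] (f : E → F) {L : ℝ} (hL : 0 < L) (η : E) (k : ℕ) :
    ‖iteratedFDeriv ℝ k (fun z => f (L • z)) η‖ ≤ L ^ k * ‖iteratedFDeriv ℝ k f (L • η)‖ := by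
  set g : E ≃L[ℝ] E := ContinuousLinearEquiv.smulLeft (Units.mk0 L hL.ne') with hg
  have hgL : ‖(g : E →L[ℝ] E)‖ ≤ L :=
    ContinuousLinearMap.opNorm_le_bound _ hL.le fun z => by
      simp [hg, Units.smul_def, norm_smul, abs_of_pos hL]
  have h := g.iteratedFDerivWithin_comp_right f uniqueDiffOn_univ (Set.mem_univ (g η)) k
  rw [Set.preimage_univ, iteratedFDerivWithin_univ, iteratedFDerivWithin_univ] at h
  have h2 : (fun z => f (L • z)) = f ∘ g := rfl
  rw [h2, h]
  refine (ContinuousMultilinearMap.norm_compContinuousLinearMap_le _ _).trans ?_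
  rw [Finset.prod_const, Finset.card_univ, Fintype.card_fin, mul_comm]
  have h3 : g η = L • η := rfl
  rw [h3]
  gcongr

/-- The overdamped solution in scaled variables: with `α = R b` and `r = R ε ρ` the discriminant
is `R² (b² - 4 ε² ρ²)`, and `λ₊` is written without cancellation. -/
theorem dampedOscillator_scaled {R b ρ ε : ℝ} (hR : 0 < R) (hb : 0 < b)
    (hd : 0 < b * b + -(4 * ε ^ 2) * ρ ^ 2) (t : ℝ) :
    dampedOscillator (R * b) (R * ε * ρ) t =
      R⁻¹ * ((√(b * b + -(4 * ε ^ 2) * ρ ^ 2))⁻¹ *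
        (Real.exp (t * (R * ε ^ 2) * (-2 * ρ ^ 2 * (b + √(b * b + -(4 * ε ^ 2) * ρ ^ 2))⁻¹)) +
          -1 * Real.exp (t * R * (-(1 / 2) * (b + √(b * b + -(4 * ε ^ 2) * ρ ^ 2)))))) := by
  set d := b * b + -(4 * ε ^ 2) * ρ ^ 2 with hd'
  have hD : (R * b) ^ 2 - 4 * (R * ε * ρ) ^ 2 = R ^ 2 * d := by rw [hd']; ring
  have hlt : 4 * (R * ε * ρ) ^ 2 < (R * b) ^ 2 := by
    have : 0 < R ^ 2 * d := by positivity
    linarith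
  have hs : √((R * b) ^ 2 - 4 * (R * ε * ρ) ^ 2) = R * √d := by
    rw [hD, Real.sqrt_mul (by positivity), Real.sqrt_sq hR.le]
  have hsd : 0 < √d := Real.sqrt_pos.mpr hd
  have hsq : √d ^ 2 = d := Real.sq_sqrt hd.le
  rw [dampedOscillator, if_pos hlt, hs]
  have e1 : (-(R * b) + R * √d) / 2 * t =
      t * (R * ε ^ 2) * (-2 * ρ ^ 2 * (b + √d)⁻¹) := by
    have : b + √d ≠ 0 := by positivity
    field_simp
    rw [hd'] at hsq
    linear_combination t * hsq
  have e2 : (-(R * b) - R * √d) / 2 * t = t * R * (-(1 / 2) * (b + √d)) := by ring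
  have e3 : (-(R * b) + R * √d) / 2 - (-(R * b) - R * √d) / 2 = R * √d := by ring
  rw [e1, e2, e3]
  field_simp
  ring

variable {n : ℕ}

/-- Scales `L ≥ M` together with points of the annulus `1 ≤ ‖η‖ ≤ 4`. -/
abbrev AnnulusIndex (n : ℕ) (M : ℝ) : Type :=
  {p : ℝ × EuclideanSpace ℝ (Fin n) // M ≤ p.1 ∧ 1 ≤ ‖p.2‖ ∧ ‖p.2‖ ≤ 4}

variable {a : EuclideanSpace ℝ (Fin n) → ℝ} {θ M : ℝ}

/-- The rescaled symbols `L ^ (-θ) a (L ·)`, `L ≥ M`, have uniformly bounded derivatives on the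
annulus `1 ≤ ‖η‖ ≤ 4`. -/
theorem bddJets_rescaled_symbol
    (ha : ContDiffOn ℝ ((n + 1 : ℕ) : WithTop ℕ∞) a {0}ᶜ) (hθ2 : θ ≤ 2) (hM : 0 < M)
    (ha_high : HighFrequencySymbol a θ M) :
    BddJets (n + 1) (fun (i : AnnulusIndex n M) z => a (i.1.1 • z) * i.1.1 ^ (-θ))
      (fun i => i.1.2) := by
  obtain ⟨a₁, ha₁, C, hC, H⟩ := ha_high
  refine ⟨((n : ℝ) + 1) ^ (n + 1) * (C * 16), fun ⟨⟨L, η⟩, hL, hη1, hη4⟩ => ?_⟩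
  simp only at hL hη1 hη4 ⊢
  have hL0 : 0 < L := hM.trans_le hL
  have hη0 : 0 < ‖η‖ := by linarith
  have hLη : L • η ≠ 0 := smul_ne_zero hL0.ne' (norm_pos_iff.mp hη0)
  have hnorm : ‖L • η‖ = L * ‖η‖ := by rw [norm_smul, Real.norm_of_nonneg hL0.le]
  have haL : ContDiffAt ℝ ((n + 1 : ℕ) : WithTop ℕ∞) a (L • η) :=
    ha.contDiffAt (isOpen_compl_singleton.mem_nhds hLη)
  have hcomp : ContDiffAt ℝ ((n + 1 : ℕ) : WithTop ℕ∞) (fun z => a (L • z)) η :=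
    haL.comp η (by fun_prop)
  refine ⟨hcomp.mul contDiffAt_const, fun k hk => ?_⟩
  have e1 : (fun z => a (L • z) * L ^ (-θ)) = (fun z => L ^ (-θ) • a (L • z)) := by
    funext z; rw [smul_eq_mul, mul_comm]
  rw [e1, iteratedFDeriv_const_smul_apply' (hcomp.of_le (by exact_mod_cast hk)), norm_smul,
    Real.norm_of_nonneg (by positivity)]
  have h1 := norm_iteratedFDeriv_comp_smul_le a hL0 η k
  have h2 := norm_iteratedFDeriv_le_of_partialDeriv (f := a) (ξ := L • η)
    (B := C * ‖L • η‖ ^ (θ - (k : ℝ)))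
    ((H (L • η) (by rw [hnorm]; nlinarith)).2 k hk)
  rw [abs_of_nonneg (by positivity), hnorm, Real.mul_rpow hL0.le hη0.le] at h2
  have h3 : ‖η‖ ^ (θ - (k : ℝ)) ≤ 16 := by
    calc ‖η‖ ^ (θ - (k : ℝ)) ≤ ‖η‖ ^ (2 : ℝ) :=
          Real.rpow_le_rpow_of_exponent_le hη1 (by have : (0 : ℝ) ≤ k := by positivity
                                                   linarith)
      _ ≤ 4 ^ (2 : ℝ) := Real.rpow_le_rpow hη0.le hη4 (by norm_num)
      _ = 16 := by norm_num
  have h4 : L ^ (-θ) * (L ^ k * L ^ (θ - (k : ℝ))) = 1 := by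
    rw [← Real.rpow_natCast L k, ← Real.rpow_add hL0, ← Real.rpow_add hL0]
    simp
  calc _ ≤ L ^ (-θ) * (L ^ k * (n ^ k * (C * (L ^ (θ - (k : ℝ)) * ‖η‖ ^ (θ - (k : ℝ)))))) := by
        gcongr
        exact h1.trans (by gcongr)
    _ = (L ^ (-θ) * (L ^ k * L ^ (θ - (k : ℝ)))) * (n ^ k * (C * ‖η‖ ^ (θ - (k : ℝ)))) := by ring
    _ = n ^ k * (C * ‖η‖ ^ (θ - (k : ℝ))) := by rw [h4, one_mul]
    _ ≤ ((n : ℝ) + 1) ^ (n + 1) * (C * 16) := by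
        gcongr
        calc (n : ℝ) ^ k ≤ ((n : ℝ) + 1) ^ k := by gcongr; linarith
          _ ≤ ((n : ℝ) + 1) ^ (n + 1) := pow_le_pow_right₀ (by
            have : (0 : ℝ) ≤ n := by positivity
            linarith) hk

set_option maxHeartbeats 1000000 in
/-- Uniform bounds for the derivatives of the rescaled multiplier `K̂(t, L ·)` on the annulus
`1 ≤ ‖η‖ ≤ 4`. By `dampedOscillator_scaled` with `R = L ^ θ` and `ε = L ^ (1 - θ)`, it is composed
of families with bounded jets and of exponentials at times `t L ^ (2 - θ)` and `t L ^ θ`. -/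
theorem bddJets_rescaled_multiplier
    (ha : ContDiffOn ℝ ((n + 1 : ℕ) : WithTop ℕ∞) a {0}ᶜ) (ha_pos : ∀ ξ, ξ ≠ 0 → 0 < a ξ)
    (hθ : 1 < θ) (hθ2 : θ ≤ 2) (hM : 0 < M) (ha_high : HighFrequencySymbol a θ M)
    (ha_over : ∀ ξ, M ≤ ‖ξ‖ → 4 * ‖ξ‖ ≤ a ξ) :
    ∃ c > (0 : ℝ), BddJets (n + 1) (fun (i : AnnulusIndex n M × {t : ℝ // 0 < t}) z =>
      Real.exp (c * (i.2.1 * i.1.1.1 ^ (2 - θ))) *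
        (i.1.1.1 ^ θ * dampedOscillator (a (i.1.1.1 • z)) ‖i.1.1.1 • z‖ i.2.1))
      (fun i => i.1.1.2) := by
  set x : AnnulusIndex n M → EuclideanSpace ℝ (Fin n) := fun i => i.1.2 with hx
  set b : AnnulusIndex n M → EuclideanSpace ℝ (Fin n) → ℝ :=
    fun i z => a (i.1.1 • z) * i.1.1 ^ (-θ) with hb
  have hbJ : BddJets (n + 1) b x := bddJets_rescaled_symbol ha hθ2 hM ha_high
  obtain ⟨a₁, ha₁, C₀, -, H⟩ := ha_high
  have hL0 : ∀ i : AnnulusIndex n M, 0 < i.1.1 := fun i => hM.trans_le i.2.1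
  have hη0 : ∀ i : AnnulusIndex n M, 0 < ‖x i‖ := fun i => zero_lt_one.trans_le i.2.2.1
  have hnorm : ∀ (i : AnnulusIndex n M) (z : EuclideanSpace ℝ (Fin n)),
      ‖i.1.1 • z‖ = i.1.1 * ‖z‖ := fun i z => by
    rw [norm_smul, Real.norm_of_nonneg (hL0 i).le]
  have hMle : ∀ i : AnnulusIndex n M, M ≤ ‖i.1.1 • x i‖ := fun i => by
    rw [hnorm]
    exact i.2.1.trans (le_mul_of_one_le_right (hL0 i).le i.2.2.1)
  have hbpos : ∀ i z, z ≠ 0 → 0 < b i z := fun i z hz =>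
    mul_pos (ha_pos _ (smul_ne_zero (hL0 i).ne' hz)) (Real.rpow_pos_of_pos (hL0 i) _)
  have hb1 : ∀ i, a₁ ≤ b i (x i) := fun i => by
    have h1 := (H _ (hMle i)).1
    rw [hnorm, Real.mul_rpow (hL0 i).le (hη0 i).le] at h1
    have h2 : 1 ≤ ‖x i‖ ^ θ := Real.one_le_rpow i.2.2.1 (by linarith)
    have h3 : i.1.1 ^ θ * i.1.1 ^ (-θ) = 1 := by
      rw [← Real.rpow_add (hL0 i)]; simp
    calc a₁ = a₁ * (i.1.1 ^ θ * 1) * i.1.1 ^ (-θ) := by rw [mul_one, mul_assoc, h3, mul_one]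
      _ ≤ a₁ * (i.1.1 ^ θ * ‖x i‖ ^ θ) * i.1.1 ^ (-θ) := by
          have := hL0 i
          gcongr
      _ ≤ b i (x i) := by
          simp only [hb]
          have := hL0 i
          gcongr
  obtain ⟨B, hB⟩ := hbJ.exists_norm_le
  have hbB : ∀ i, b i (x i) ≤ B := fun i => (le_abs_self _).trans (hB i)
  set ε : AnnulusIndex n M → ℝ := fun i => i.1.1 ^ (1 - θ) with hε
  have hε0 : ∀ i, 0 < ε i := fun i => Real.rpow_pos_of_pos (hL0 i) _
  have hεM : ∀ i, ε i ≤ M ^ (1 - θ) := fun i =>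
    Real.rpow_le_rpow_of_nonpos hM i.2.1 (by linarith)
  have hLε : ∀ i, i.1.1 ^ θ * ε i = i.1.1 := fun i => by
    rw [hε, ← Real.rpow_add (hL0 i)]; simp
  -- The normalized discriminant `d = b² - 4 ε² ‖z‖²` stays away from `0`, because `4 ‖ξ‖ ≤ a ξ`
  -- means `4 ε ‖z‖ ≤ b`.
  have hsqJ : BddJets (n + 1) (fun (_ : AnnulusIndex n M) (z : EuclideanSpace ℝ (Fin n)) =>
      ‖z‖ ^ 2) x :=
    BddJets.of_contDiffOn isOpen_univ (isCompact_closedBall (0 : EuclideanSpace ℝ (Fin n)) 4)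
      (Set.subset_univ _) (contDiff_norm_sq ℝ).contDiffOn
      (fun i => by simpa using i.2.2.2)
  set d : AnnulusIndex n M → EuclideanSpace ℝ (Fin n) → ℝ :=
    fun i z => b i z * b i z + -(4 * ε i ^ 2) * ‖z‖ ^ 2 with hd
  have hdJ : BddJets (n + 1) d x := by
    refine (hbJ.mul hbJ).add (BddJets.mul (BddJets.of_const ⟨4 * (M ^ (1 - θ)) ^ 2, fun i => ?_⟩)
      hsqJ)
    rw [norm_neg, Real.norm_of_nonneg (by positivity)]
    have := hε0 i
    gcongr
    exact hεM i
  have hd1 : ∀ i, 3 / 4 * a₁ ^ 2 ≤ d i (x i) := fun i => by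
    have h1 := ha_over _ (hMle i)
    rw [hnorm] at h1
    have h2 : 4 * ε i * ‖x i‖ ≤ b i (x i) := by
      have h3 : i.1.1 * i.1.1 ^ (-θ) = ε i := by
        rw [hε]
        nth_rw 1 [← Real.rpow_one i.1.1]
        rw [← Real.rpow_add (hL0 i)]
        congr 1
      calc 4 * ε i * ‖x i‖ = 4 * (i.1.1 * ‖x i‖) * i.1.1 ^ (-θ) := by rw [← h3]; ring
        _ ≤ _ := by
          simp only [hb]
          have := hL0 i
          gcongr
    have h4 : 0 ≤ 4 * ε i * ‖x i‖ := by have := hε0 i; positivity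
    simp only [hd]
    nlinarith [hb1 i, mul_self_le_mul_self h4 h2, mul_self_le_mul_self ha₁.le (hb1 i)]
  have hd0 : ∀ i, 0 < d i (x i) := fun i => lt_of_lt_of_le (by positivity) (hd1 i)
  obtain ⟨D, hD⟩ := hdJ.exists_norm_le
  have hdD : ∀ i, d i (x i) ≤ D := fun i => (le_abs_self _).trans (hD i)
  set s : AnnulusIndex n M → EuclideanSpace ℝ (Fin n) → ℝ := fun i z => √(d i z) with hs
  have hsJ : BddJets (n + 1) s x :=
    BddJets.comp (g := fun _ y => √y)
      (BddJets.of_contDiffOn (U := Set.Ioi 0) isOpen_Ioi (K := Set.Icc (3 / 4 * a₁ ^ 2) D)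
        isCompact_Icc (fun y hy => lt_of_lt_of_le (by positivity) hy.1)
        (fun y hy => (Real.contDiffAt_sqrt (ne_of_gt hy)).contDiffWithinAt)
        fun i => ⟨hd1 i, hdD i⟩) hdJ
  have hs1 : ∀ i, √(3 / 4 * a₁ ^ 2) ≤ s i (x i) := fun i => Real.sqrt_le_sqrt (hd1 i)
  have hsD : ∀ i, s i (x i) ≤ √D := fun i => Real.sqrt_le_sqrt (hdD i)
  have hinvJ : ∀ {f : AnnulusIndex n M → EuclideanSpace ℝ (Fin n) → ℝ} {u v : ℝ}, 0 < u →
      (∀ i, u ≤ f i (x i)) → (∀ i, f i (x i) ≤ v) → BddJets (n + 1) f x →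
      BddJets (n + 1) (fun i z => (f i z)⁻¹) x := fun {f u v} hu hf1 hf2 hf =>
    BddJets.comp (g := fun _ y => y⁻¹)
      (BddJets.of_contDiffOn (U := Set.Ioi 0) isOpen_Ioi (K := Set.Icc u v)
        isCompact_Icc (fun y hy => lt_of_lt_of_le hu hy.1)
        (fun y hy => (contDiffAt_inv ℝ (ne_of_gt hy)).contDiffWithinAt)
        fun i => ⟨hf1 i, hf2 i⟩) hf
  have hwJ : BddJets (n + 1) (fun i z => (s i z)⁻¹) x := hinvJ (by positivity) hs1 hsD hsJ
  have hbsJ : BddJets (n + 1) (fun i z => b i z + s i z) x := hbJ.add hsJ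
  have hbs1 : ∀ i, a₁ ≤ b i (x i) + s i (x i) := fun i =>
    (hb1 i).trans (le_add_of_nonneg_right (Real.sqrt_nonneg _))
  have hbs2 : ∀ i, b i (x i) + s i (x i) ≤ B + √D := fun i => add_le_add (hbB i) (hsD i)
  have hbsinv := hinvJ ha₁ hbs1 hbs2 hbsJ
  -- The exponents `gp = λ₊ / L ^ (2 - θ)` and `gm = λ₋ / L ^ θ` are negative and stay away
  -- from `0`.
  set gp : AnnulusIndex n M → EuclideanSpace ℝ (Fin n) → ℝ :=
    fun i z => -2 * ‖z‖ ^ 2 * (b i z + s i z)⁻¹ with hgp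
  have hgpJ : BddJets (n + 1) gp x :=
    ((BddJets.of_const ⟨2, fun _ => by simp⟩).mul hsqJ).mul hbsinv
  set gm : AnnulusIndex n M → EuclideanSpace ℝ (Fin n) → ℝ :=
    fun i z => -(1 / 2) * (b i z + s i z) with hgm
  have hgmJ : BddJets (n + 1) gm x :=
    (BddJets.of_const ⟨1, fun _ => by norm_num⟩).mul hbsJ
  set S : ℝ := max (B + √D) 1 with hS
  have hS0 : 0 < S := by positivity
  have hgp1 : ∀ i, gp i (x i) ≤ -(2 * S⁻¹) := fun i => by
    have h1 : 1 ≤ ‖x i‖ ^ 2 := one_le_pow₀ i.2.2.1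
    have h2 : S⁻¹ ≤ (b i (x i) + s i (x i))⁻¹ :=
      inv_anti₀ (ha₁.trans_le (hbs1 i)) ((hbs2 i).trans (le_max_left _ _))
    have h3 : S⁻¹ ≤ ‖x i‖ ^ 2 * (b i (x i) + s i (x i))⁻¹ :=
      calc S⁻¹ = 1 * S⁻¹ := (one_mul _).symm
        _ ≤ _ := by gcongr
    simp only [hgp]
    linarith
  have hgm1 : ∀ i, gm i (x i) ≤ -(2 * (a₁ / 4)) := fun i => by
    simp only [hgm]
    linarith [hbs1 i]
  set c : ℝ := min S⁻¹ (a₁ / 4 * M ^ (2 * θ - 2)) with hc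
  have hc0 : 0 < c := by positivity
  refine ⟨c, hc0, ?_⟩
  set τ : AnnulusIndex n M × {t : ℝ // 0 < t} → ℝ := fun i => i.2.1 * i.1.1.1 ^ (2 - θ) with hτ
  set τ' : AnnulusIndex n M × {t : ℝ // 0 < t} → ℝ := fun i => i.2.1 * i.1.1.1 ^ θ with hτ'
  have hτ0 : ∀ i, 0 ≤ τ i := fun i =>
    mul_nonneg i.2.2.le (Real.rpow_pos_of_pos (hL0 i.1) _).le
  have hτ'0 : ∀ i, 0 ≤ τ' i := fun i =>
    mul_nonneg i.2.2.le (Real.rpow_pos_of_pos (hL0 i.1) _).le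
  have hττ' : ∀ i, c * τ i ≤ a₁ / 4 * τ' i := fun i => by
    have h1 : M ^ (2 * θ - 2) * i.1.1.1 ^ (2 - θ) ≤ i.1.1.1 ^ θ := by
      calc _ ≤ i.1.1.1 ^ (2 * θ - 2) * i.1.1.1 ^ (2 - θ) := by
            have := hL0 i.1
            gcongr
            · linarith
            · exact i.1.2.1
        _ = i.1.1.1 ^ θ := by rw [← Real.rpow_add (hL0 i.1)]; congr 1; ring
    calc c * τ i ≤ (a₁ / 4 * M ^ (2 * θ - 2)) * τ i :=
          mul_le_mul_of_nonneg_right (min_le_right _ _) (hτ0 i)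
      _ = a₁ / 4 * (i.2.1 * (M ^ (2 * θ - 2) * i.1.1.1 ^ (2 - θ))) := by simp only [hτ]; ring
      _ ≤ a₁ / 4 * (i.2.1 * i.1.1.1 ^ θ) := by
          have := i.2.2
          gcongr
  have hepJ : BddJets (n + 1) (fun i z => Real.exp (c * τ i - S⁻¹ * τ i) *
      (Real.exp (S⁻¹ * τ i) * Real.exp (τ i * gp i.1 z))) (fun i => x i.1) := by
    refine BddJets.mul (BddJets.of_const ⟨1, fun i => ?_⟩)
      (BddJets.comp (g := fun i y => Real.exp (S⁻¹ * τ i) * Real.exp (τ i * y))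
        (f := fun i => gp i.1)
        (BddJets.exp_mul (y := fun i => gp i.1 (x i.1)) hτ0 (inv_pos.mpr hS0) fun i => hgp1 i.1)
        (hgpJ.comp_index Prod.fst))
    rw [Real.norm_of_nonneg (Real.exp_pos _).le, Real.exp_le_one_iff]
    have := mul_le_mul_of_nonneg_right (min_le_left S⁻¹ (a₁ / 4 * M ^ (2 * θ - 2))) (hτ0 i)
    linarith
  have hemJ : BddJets (n + 1) (fun i z => Real.exp (c * τ i - a₁ / 4 * τ' i) *
      (Real.exp (a₁ / 4 * τ' i) * Real.exp (τ' i * gm i.1 z))) (fun i => x i.1) := by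
    refine BddJets.mul (BddJets.of_const ⟨1, fun i => ?_⟩)
      (BddJets.comp (g := fun i y => Real.exp (a₁ / 4 * τ' i) * Real.exp (τ' i * y))
        (f := fun i => gm i.1)
        (BddJets.exp_mul (y := fun i => gm i.1 (x i.1)) hτ'0 (by positivity) fun i => hgm1 i.1)
        (hgmJ.comp_index Prod.fst))
    rw [Real.norm_of_nonneg (Real.exp_pos _).le, Real.exp_le_one_iff]
    linarith [hττ' i]
  have hwJ' : BddJets (n + 1) (fun (i : AnnulusIndex n M × {t : ℝ // 0 < t}) z => (s i.1 z)⁻¹)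
      (fun i => x i.1) := hwJ.comp_index Prod.fst
  have hem' : BddJets (n + 1) (fun (i : AnnulusIndex n M × {t : ℝ // 0 < t}) z =>
      -1 * (Real.exp (c * τ i - a₁ / 4 * τ' i) *
        (Real.exp (a₁ / 4 * τ' i) * Real.exp (τ' i * gm i.1 z)))) (fun i => x i.1) :=
    BddJets.mul (BddJets.of_const (c := fun _ => (-1 : ℝ)) ⟨1, fun _ => by simp⟩) hemJ
  have hsum := hwJ'.mul (hepJ.add hem')
  refine BddJets.congr hsum fun i => ?_
  have hdc : ContinuousAt (d i.1) (x i.1) := (hdJ.contDiffAt i.1).continuousAt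
  filter_upwards [hdc.eventually_const_lt (hd0 i.1),
    isOpen_compl_singleton.mem_nhds (norm_pos_iff.mp (hη0 i.1))] with z hz hz0
  set L := i.1.1.1 with hL
  have hL1 : 0 < L := hL0 i.1
  have hR : 0 < L ^ θ := Real.rpow_pos_of_pos hL1 _
  have e1 : a (L • z) = L ^ θ * b i.1 z := by
    simp only [hb]
    rw [mul_comm, mul_assoc, ← Real.rpow_add hL1, neg_add_cancel, Real.rpow_zero, mul_one]
  have e2 : ‖L • z‖ = L ^ θ * ε i.1 * ‖z‖ := by rw [hnorm, hLε]
  have e3 : L ^ θ * ε i.1 ^ 2 = L ^ (2 - θ) := by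
    simp only [hε]
    rw [← Real.rpow_natCast, ← Real.rpow_mul hL1.le, ← Real.rpow_add hL1]
    congr 1; push_cast; ring
  rw [e1, e2, dampedOscillator_scaled hR (hbpos i.1 z hz0) hz, e3, mul_inv_cancel_left₀ hR.ne']
  have e4 : ∀ u v w : ℝ, Real.exp (u - v) * (Real.exp v * w) = Real.exp u * w := fun u v w => by
    rw [← mul_assoc, ← Real.exp_add, sub_add_cancel]
  simp only [e4, hgp, hgm, hs, hd, hτ, hτ', ← hL]
  ring

end Symbol

/-! ### Kernels of Fourier multipliers -/

section Kernel

variable {V : Type*} [NormedAddCommGroup V] [InnerProductSpace ℝ V] [FiniteDimensional ℝ V]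
  [MeasurableSpace V] [BorelSpace V]

theorem continuous_fourier_of_integrable {f : V → ℂ} (hf : Integrable f) : Continuous (𝓕 f) :=
  VectorFourier.fourierIntegral_continuous Real.continuous_fourierChar
    (by exact continuous_inner) hf

theorem integral_fourierInv_mul_eq_of_integrable {f g : V → ℂ} (hf : Integrable f)
    (hg : Integrable g) : ∫ η, (𝓕⁻ f) η * g η = ∫ y, f y * (𝓕⁻ g) y := by
  have h1 : ∫ η, (𝓕⁻ f) η * g η = ∫ η, (𝓕 f) η * g (-η) := by
    rw [← integral_neg_eq_self]
    simp only [Real.fourierInv_eq_fourier_neg, neg_neg]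
  have hg' : Integrable fun η => g (-η) := hg.comp_neg
  have h2 : ∫ η, (𝓕 f) η * g (-η) = ∫ y, f y * (𝓕 fun η => g (-η)) y := by
    simpa using! VectorFourier.integral_fourierIntegral_smul_eq_flip (L := innerₗ V)
      Real.continuous_fourierChar continuous_inner hf hg'
  rw [h1, h2]
  refine integral_congr_ae (Filter.Eventually.of_forall fun y => ?_)
  have h3 := Real.fourier_comp_linearIsometry (LinearIsometryEquiv.neg ℝ (E := V)) g y
  simp only [Real.fourierInv_eq_fourier_neg]
  congr 1

theorem fourierInv_comp_inv_smul (f : V → ℂ) {R : ℝ} (hR : 0 < R) (w : V) :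
    𝓕⁻ (fun v => f (R⁻¹ • v)) w = (R ^ Module.finrank ℝ V : ℝ) • 𝓕⁻ f (R • w) := by
  rw [Real.fourierInv_eq', Real.fourierInv_eq',
    ← Measure.integral_comp_inv_smul_of_nonneg volume (fun v =>
      Complex.exp ((2 * Real.pi * inner ℝ v (R • w) : ℝ) * Complex.I) • f v) hR.le]
  refine integral_congr_ae (Filter.Eventually.of_forall fun v => ?_)
  simp only
  rw [inner_smul_left, inner_smul_right]
  congr 5
  simp only [conj_trivial]
  field_simp

/-- Bounds for `N` derivatives of a function supported in a fixed ball give decay of order `N` of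
its inverse Fourier transform. -/
theorem exists_norm_fourierInv_le (N : ℕ) (r : ℝ) :
    ∃ C : ℝ, 0 < C ∧ ∀ (f : V → ℂ) (A : ℝ), 0 ≤ A → ContDiff ℝ N f →
      (∀ η, r < ‖η‖ → f η = 0) → (∀ k ≤ N, ∀ η, ‖iteratedFDeriv ℝ k f η‖ ≤ A) →
      ∀ w, ‖𝓕⁻ f w‖ ≤ C * A * ((1 + ‖w‖) ^ N)⁻¹ := by
  set v : ℝ := volume.real (Metric.closedBall (0 : V) r) with hv
  have hv0 : 0 ≤ v := measureReal_nonneg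
  refine ⟨2 ^ (N - 1) * (v + 2 ^ N * ((N + 1) * v)) + 1, by positivity, ?_⟩
  intro f A hA hf hsupp hbd w
  have hd0 : ∀ k η, η ∉ Metric.closedBall (0 : V) r → iteratedFDeriv ℝ k f η = 0 := by
    intro k η hη
    have : f =ᶠ[nhds η] fun _ => 0 := by
      filter_upwards [Metric.isClosed_closedBall.isOpen_compl.mem_nhds hη] with z hz
      exact hsupp z (by simpa using hz)
    rw [(this.iteratedFDeriv ℝ k).eq_of_nhds]
    simp
  have hint : ∀ k ≤ N, Integrable (fun η => ‖iteratedFDeriv ℝ k f η‖) ∧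
      ∫ η, ‖iteratedFDeriv ℝ k f η‖ ≤ v * A := by
    intro k hk
    have hmaj : Integrable ((Metric.closedBall (0 : V) r).indicator fun _ => A) :=
      (integrable_indicator_iff measurableSet_closedBall).mpr
        (integrableOn_const (measure_closedBall_lt_top.ne))
    have hle : ∀ η, ‖iteratedFDeriv ℝ k f η‖ ≤
        (Metric.closedBall (0 : V) r).indicator (fun _ => A) η := by
      intro η
      by_cases hη : η ∈ Metric.closedBall (0 : V) r
      · rw [Set.indicator_of_mem hη]; exact hbd k hk η
      · rw [Set.indicator_of_notMem hη, hd0 k η hη, norm_zero]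
    have hcont : Continuous fun η => ‖iteratedFDeriv ℝ k f η‖ :=
      (hf.continuous_iteratedFDeriv (by exact_mod_cast hk)).norm
    have hI : Integrable fun η => ‖iteratedFDeriv ℝ k f η‖ :=
      hmaj.mono' hcont.aestronglyMeasurable
        (Filter.Eventually.of_forall fun η => by rw [norm_norm]; exact hle η)
    refine ⟨hI, (integral_mono hI hmaj hle).trans (le_of_eq ?_)⟩
    rw [integral_indicator measurableSet_closedBall, setIntegral_const, smul_eq_mul]
  have hdecay : ∀ m ≤ N, ‖w‖ ^ m * ‖𝓕⁻ f w‖ ≤ 2 ^ m * ((m + 1) * (v * A)) := by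
    intro m hm
    have h := Real.pow_mul_norm_iteratedFDeriv_fourier_le (f := f) (K := 0) (N := N)
      (by exact_mod_cast hf) (fun k l hk hl => by
        have hk0 : k = 0 := by simpa using hk
        subst hk0
        simpa using (hint l (by exact_mod_cast hl)).1) (k := 0) (n := m) (by simp)
        (by exact_mod_cast hm) (-w)
    rw [norm_neg, norm_iteratedFDeriv_zero, ← Real.fourierInv_eq_fourier_neg] at h
    refine h.trans ?_
    simp only [pow_zero, one_mul, Nat.cast_zero, mul_zero, zero_add]
    gcongr
    rw [Finset.sum_product]
    simp only [Finset.range_one, Finset.sum_singleton, pow_zero, one_mul]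
    calc _ ≤ ∑ _l ∈ Finset.range (m + 1), v * A :=
          Finset.sum_le_sum fun l hl =>
            (hint l (by have := Finset.mem_range.mp hl; omega)).2
      _ = _ := by simp
  rw [← div_eq_mul_inv, le_div_iff₀ (by positivity), mul_comm]
  have h0 := hdecay 0 (Nat.zero_le _)
  have hN := hdecay N le_rfl
  simp only [pow_zero, one_mul, Nat.cast_zero, zero_add] at h0
  calc (1 + ‖w‖) ^ N * ‖𝓕⁻ f w‖
      ≤ (2 ^ (N - 1) * (1 ^ N + ‖w‖ ^ N)) * ‖𝓕⁻ f w‖ := by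
        gcongr
        exact add_pow_le zero_le_one (norm_nonneg w) N
    _ = 2 ^ (N - 1) * (‖𝓕⁻ f w‖ + ‖w‖ ^ N * ‖𝓕⁻ f w‖) := by rw [one_pow]; ring
    _ ≤ 2 ^ (N - 1) * (v * A + 2 ^ N * ((N + 1) * (v * A))) := by gcongr
    _ = (2 ^ (N - 1) * (v + 2 ^ N * ((N + 1) * v))) * A := by ring
    _ ≤ _ := by gcongr; linarith

variable {n : ℕ}

theorem inverseFourier_apply_eq_integral {m : EuclideanSpace ℝ (Fin n) → ℂ}
    (hm : MemLp (fun η => m ((2 * Real.pi) • η)) ∞ volume)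
    (g : 𝓢(EuclideanSpace ℝ (Fin n), ℂ)) :
    inverseFourier m g = ∫ η, (𝓕⁻ ⇑g) η * m ((2 * Real.pi) • η) := by
  rw [inverseFourier, TemperedDistribution.fourierInv_apply, distributionOfBounded, dif_pos hm,
    Lp.toTemperedDistribution_apply]
  apply integral_congr_ae
  filter_upwards [hm.coeFn_toLp] with η hη
  rw [hη, smul_eq_mul, SchwartzMap.fourierInv_coe]

/-- Convolution with the inverse Fourier transform of a bounded multiplier that is the pointwise
limit of uniformly bounded partial sums of integrable pieces. -/
theorem tendsto_sum_integral_distributionConv {m : EuclideanSpace ℝ (Fin n) → ℂ}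
    (hm : MemLp (fun η => m ((2 * Real.pi) • η)) ∞ volume)
    {h : ℕ → EuclideanSpace ℝ (Fin n) → ℂ} (hh : ∀ j, Integrable (h j)) {B : ℝ}
    (hB : ∀ N η, ‖∑ j ∈ Finset.range N, h j η‖ ≤ B)
    (hlim : ∀ η, Filter.Tendsto (fun N => ∑ j ∈ Finset.range N, h j η) Filter.atTop
      (nhds (m ((2 * Real.pi) • η))))
    (f : 𝓢(EuclideanSpace ℝ (Fin n), ℂ)) (x : EuclideanSpace ℝ (Fin n)) :
    Filter.Tendsto (fun N => ∑ j ∈ Finset.range N, ∫ y, f (x - y) * (𝓕⁻ (h j)) y) Filter.atTop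
      (nhds (distributionConv (inverseFourier m) f x)) := by
  set g := reflectTranslate f x with hg
  have hgI : Integrable ⇑g := g.integrable
  have hFI : Integrable (𝓕⁻ ⇑g) := by
    rw [← SchwartzMap.fourierInv_coe]
    exact (𝓕⁻ g).integrable
  have hFc : Continuous (𝓕⁻ ⇑g) := by
    rw [← SchwartzMap.fourierInv_coe]
    exact (𝓕⁻ g).continuous
  obtain ⟨D, hD⟩ : ∃ D, ∀ η, ‖(𝓕⁻ ⇑g) η‖ ≤ D := by
    rw [← SchwartzMap.fourierInv_coe]
    obtain ⟨D, hD⟩ := (𝓕⁻ g).decay 0 0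
    exact ⟨D, fun η => by simpa using hD.2 η⟩
  have hterm : ∀ j, Integrable fun η => (𝓕⁻ ⇑g) η * h j η := fun j =>
    (hh j).bdd_mul hFc.aestronglyMeasurable (Filter.Eventually.of_forall hD)
  have h1 : distributionConv (inverseFourier m) f x =
      ∫ η, (𝓕⁻ ⇑g) η * m ((2 * Real.pi) • η) := inverseFourier_apply_eq_integral hm g
  have h2 : ∀ N, ∑ j ∈ Finset.range N, ∫ y, f (x - y) * (𝓕⁻ (h j)) y =
      ∫ η, (𝓕⁻ ⇑g) η * ∑ j ∈ Finset.range N, h j η := by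
    intro N
    simp_rw [Finset.mul_sum]
    rw [integral_finsetSum _ fun j _ => hterm j]
    refine Finset.sum_congr rfl fun j _ => ?_
    rw [integral_fourierInv_mul_eq_of_integrable hgI (hh j)]
    rfl
  simp_rw [h1, h2]
  refine tendsto_integral_of_dominated_convergence (fun η => ‖(𝓕⁻ ⇑g) η‖ * B) (fun N => ?_)
    (hFI.norm.mul_const B) (fun N => Filter.Eventually.of_forall fun η => ?_)
    (Filter.Eventually.of_forall fun η => (hlim η).const_mul _)
  · simp_rw [Finset.mul_sum]
    exact (integrable_finsetSum _ fun j _ => hterm j).aestronglyMeasurable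
  · rw [norm_mul]
    gcongr
    exact hB N η

end Kernel

/-! ### Dyadic decomposition -/

noncomputable section

section Dyadic

variable {n : ℕ}

/-- The piece `K̂(t, L η) (χ(η / 2) - χ(η))` of the multiplier at frequency `L`, in rescaled
variables; it is supported in the annulus `1 ≤ ‖η‖ ≤ 4`. -/
def dyadicPiece (a χ : EuclideanSpace ℝ (Fin n) → ℝ) (t L : ℝ) (η : EuclideanSpace ℝ (Fin n)) : ℝ :=
  dampedOscillator (a (L • η)) ‖L • η‖ t * (χ ((2 : ℝ)⁻¹ • η) - χ η)

variable {a χ : EuclideanSpace ℝ (Fin n) → ℝ} {θ M : ℝ}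

theorem IsCutoff.sub_eq_zero_of_le (hχ : IsCutoff χ) {η : EuclideanSpace ℝ (Fin n)}
    (hη : ‖η‖ ≤ 1) : χ ((2 : ℝ)⁻¹ • η) - χ η = 0 := by
  rw [hχ.eq_one η hη, hχ.eq_one, sub_self]
  rw [norm_smul]; norm_num; linarith

theorem IsCutoff.sub_eq_zero_of_ge (hχ : IsCutoff χ) {η : EuclideanSpace ℝ (Fin n)}
    (hη : 4 ≤ ‖η‖) : χ ((2 : ℝ)⁻¹ • η) - χ η = 0 := by
  rw [hχ.eq_zero η (by linarith), hχ.eq_zero, sub_self]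
  rw [norm_smul]; norm_num; linarith

theorem IsCutoff.exists_abs_le (hχ : IsCutoff χ) : ∃ X : ℝ, 0 ≤ X ∧ ∀ ξ, |χ ξ| ≤ X := by
  obtain ⟨X, hX⟩ := (isCompact_closedBall
    (0 : EuclideanSpace ℝ (Fin n)) 2).exists_bound_of_continuousOn hχ.smooth.continuous.continuousOn
  refine ⟨max X 0, le_max_right _ _, fun ξ => ?_⟩
  rcases le_total ‖ξ‖ 2 with h | h
  · exact (hX ξ (by simpa using h)).trans (le_max_left _ _)
  · rw [hχ.eq_zero ξ h, abs_zero]; exact le_max_right _ _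

/-- Each rescaled dyadic piece is of size `L ^ (-θ) exp (-c t L ^ (2 - θ))` together with `n + 1`
derivatives, and the multiplier is bounded at high frequencies. -/
theorem exists_norm_iteratedFDeriv_dyadicPiece_le
    (ha : ContDiffOn ℝ ((n + 1 : ℕ) : WithTop ℕ∞) a {0}ᶜ) (ha_pos : ∀ ξ, ξ ≠ 0 → 0 < a ξ)
    (hθ : 1 < θ) (hθ2 : θ ≤ 2) (hM : 0 < M) (ha_high : HighFrequencySymbol a θ M)
    (ha_over : ∀ ξ, M ≤ ‖ξ‖ → 4 * ‖ξ‖ ≤ a ξ) (hχ : IsCutoff χ) :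
    ∃ c > (0 : ℝ), ∃ C > (0 : ℝ), ∀ t > (0 : ℝ),
      (∀ L, M ≤ L → ContDiff ℝ ((n + 1 : ℕ) : WithTop ℕ∞) (dyadicPiece a χ t L) ∧
        ∀ k ≤ n + 1, ∀ η, ‖iteratedFDeriv ℝ k (dyadicPiece a χ t L) η‖ ≤
          C * L ^ (-θ) * Real.exp (-(c * (t * L ^ (2 - θ))))) ∧
      ∀ ξ, M ≤ ‖ξ‖ → |dampedOscillator (a ξ) ‖ξ‖ t| ≤ C * M ^ (-θ) := by
  obtain ⟨c, hc, hJ⟩ := bddJets_rescaled_multiplier ha ha_pos hθ hθ2 hM ha_high ha_over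
  have hψ : ContDiff ℝ ((n + 1 : ℕ) : WithTop ℕ∞)
      (fun η : EuclideanSpace ℝ (Fin n) => χ ((2 : ℝ)⁻¹ • η) - χ η) := by
    have h1 : ContDiff ℝ ((n + 1 : ℕ) : WithTop ℕ∞) χ := hχ.smooth.of_le (by exact_mod_cast le_top)
    exact (h1.comp (contDiff_const_smul _)).sub h1
  have hψJ : BddJets (n + 1) (fun (_ : AnnulusIndex n M × {t : ℝ // 0 < t})
      (η : EuclideanSpace ℝ (Fin n)) => χ ((2 : ℝ)⁻¹ • η) - χ η) (fun i => i.1.1.2) :=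
    BddJets.of_contDiffOn isOpen_univ (isCompact_closedBall (0 : EuclideanSpace ℝ (Fin n)) 4)
      (Set.subset_univ _) hψ.contDiffOn (fun i => by simpa using i.1.2.2.2)
  obtain ⟨A, hA0, hA⟩ := (hJ.mul hψJ).exists_nonneg
  obtain ⟨A', hA'⟩ := hJ.exists_norm_le
  set C : ℝ := max (max A A') 1 with hC
  have hAC : A ≤ C := (le_max_left _ _).trans (le_max_left _ _)
  have hA'C : A' ≤ C := (le_max_right _ _).trans (le_max_left _ _)
  have hC0 : 0 < C := zero_lt_one.trans_le (le_max_right _ _)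
  refine ⟨c, hc, C, hC0, fun t ht => ⟨fun L hL => ?_, fun ξ hξ => ?_⟩⟩
  · have hL0 : 0 < L := hM.trans_le hL
    set w : ℝ := L ^ (-θ) * Real.exp (-(c * (t * L ^ (2 - θ)))) with hw
    have hw0 : 0 < w := by positivity
    have hloc : ∀ η, ContDiffAt ℝ ((n + 1 : ℕ) : WithTop ℕ∞) (dyadicPiece a χ t L) η ∧
        ∀ k ≤ n + 1, ‖iteratedFDeriv ℝ k (dyadicPiece a χ t L) η‖ ≤ C * w := by
      intro η
      by_cases hη : 1 ≤ ‖η‖ ∧ ‖η‖ ≤ 4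
      · obtain ⟨h1, h2⟩ := hA ⟨⟨(L, η), hL, hη.1, hη.2⟩, ⟨t, ht⟩⟩
        simp only at h1 h2
        have e : dyadicPiece a χ t L = fun z => w • (Real.exp (c * (t * L ^ (2 - θ))) *
            (L ^ θ * dampedOscillator (a (L • z)) ‖L • z‖ t) * (χ ((2 : ℝ)⁻¹ • z) - χ z)) := by
          funext z
          have e1 : L ^ (-θ) * L ^ θ = 1 := by rw [← Real.rpow_add hL0]; simp
          have e2 : Real.exp (-(c * (t * L ^ (2 - θ)))) * Real.exp (c * (t * L ^ (2 - θ))) = 1 := by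
            rw [← Real.exp_add]; simp
          rw [dyadicPiece, smul_eq_mul, hw]
          linear_combination (-(dampedOscillator (a (L • z)) ‖L • z‖ t *
            (χ ((2 : ℝ)⁻¹ • z) - χ z))) * (e1 * (Real.exp (-(c * (t * L ^ (2 - θ)))) *
              Real.exp (c * (t * L ^ (2 - θ)))) + e2)
        rw [e]
        refine ⟨(contDiff_const_smul w).contDiffAt.comp η h1, fun k hk => ?_⟩
        rw [iteratedFDeriv_const_smul_apply' (h1.of_le (by exact_mod_cast hk)), norm_smul,
          Real.norm_of_nonneg hw0.le, mul_comm]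
        gcongr
        exact (h2 k hk).trans hAC
      · have e : dyadicPiece a χ t L =ᶠ[nhds η] fun _ => 0 := by
          rw [not_and_or, not_le, not_le] at hη
          rcases hη with hη | hη
          · filter_upwards [continuous_norm.continuousAt.eventually_lt_const hη] with z hz
            rw [dyadicPiece, hχ.sub_eq_zero_of_le hz.le, mul_zero]
          · filter_upwards [continuous_norm.continuousAt.eventually_const_lt hη] with z hz
            rw [dyadicPiece, hχ.sub_eq_zero_of_ge hz.le, mul_zero]
        refine ⟨contDiffAt_const.congr_of_eventuallyEq e, fun k _ => ?_⟩
        rw [(e.iteratedFDeriv ℝ k).eq_of_nhds]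
        simp only [iteratedFDeriv_fun_zero, Pi.zero_apply, norm_zero]
        positivity
    refine ⟨contDiff_iff_contDiffAt.mpr fun η => (hloc η).1, fun k hk η => ?_⟩
    rw [mul_assoc]
    exact (hloc η).2 k hk
  · have hξ0 : 0 < ‖ξ‖ := hM.trans_le hξ
    have hn1 : ‖‖ξ‖⁻¹ • ξ‖ = 1 := norm_smul_inv_norm (𝕜 := ℝ) (norm_pos_iff.mp hξ0)
    have h := hA' ⟨⟨(‖ξ‖, ‖ξ‖⁻¹ • ξ), hξ, hn1.ge, by rw [hn1]; norm_num⟩, ⟨t, ht⟩⟩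
    simp only [smul_inv_smul₀ hξ0.ne'] at h
    rw [norm_mul, norm_mul, Real.norm_of_nonneg (Real.exp_pos _).le,
      Real.norm_of_nonneg (by positivity), Real.norm_eq_abs] at h
    have h1 : ‖ξ‖ ^ θ * |dampedOscillator (a ξ) ‖ξ‖ t| ≤ C := by
      refine le_trans ?_ (h.trans hA'C)
      exact le_mul_of_one_le_left (by positivity) (Real.one_le_exp (by positivity))
    calc |dampedOscillator (a ξ) ‖ξ‖ t|
        = ‖ξ‖ ^ (-θ) * (‖ξ‖ ^ θ * |dampedOscillator (a ξ) ‖ξ‖ t|) := by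
          rw [← mul_assoc, ← Real.rpow_add hξ0]; simp
      _ ≤ ‖ξ‖ ^ (-θ) * C := by gcongr
      _ ≤ M ^ (-θ) * C := by
          gcongr ?_ * _
          exact Real.rpow_le_rpow_of_nonpos hM hξ (by linarith)
      _ = _ := mul_comm _ _

theorem sum_dyadicPiece (hM : 0 < M) (t : ℝ) (ξ : EuclideanSpace ℝ (Fin n)) (N : ℕ) :
    ∑ j ∈ Finset.range N, dyadicPiece a χ t (2 ^ j * M) ((2 ^ j * M)⁻¹ • ξ) =
      dampedOscillator (a ξ) ‖ξ‖ t * (χ ((2 ^ N * M)⁻¹ • ξ) - χ (M⁻¹ • ξ)) := by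
  have h : ∀ j : ℕ, dyadicPiece a χ t (2 ^ j * M) ((2 ^ j * M)⁻¹ • ξ) =
      dampedOscillator (a ξ) ‖ξ‖ t *
        (χ ((2 ^ (j + 1) * M)⁻¹ • ξ) - χ ((2 ^ j * M)⁻¹ • ξ)) := by
    intro j
    have h0 : (2 : ℝ) ^ j * M ≠ 0 := by positivity
    rw [dyadicPiece, smul_inv_smul₀ h0, smul_smul]
    congr 4
    rw [pow_succ]
    field_simp
  simp_rw [h]
  rw [← Finset.mul_sum, Finset.sum_range_sub (fun j => χ ((2 ^ j * M)⁻¹ • ξ))]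
  simp

/-- The pieces at the frequencies `2 ^ j M` add up to the high-frequency symbol: by telescoping, the
partial sums are eventually constant. -/
theorem tendsto_sum_dyadicPiece (hM : 0 < M) (hχ : IsCutoff χ) (t : ℝ)
    (ξ : EuclideanSpace ℝ (Fin n)) :
    Filter.Tendsto (fun N => ∑ j ∈ Finset.range N,
      ((dyadicPiece a χ t (2 ^ j * M) ((2 ^ j * M)⁻¹ • ξ) : ℝ) : ℂ)) Filter.atTop
      (nhds (highFreqSymbol a χ M t ξ)) := by
  refine tendsto_const_nhds.congr' ?_
  have h1 : Filter.Tendsto (fun N : ℕ => (2 : ℝ) ^ N * M) Filter.atTop Filter.atTop :=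
    (tendsto_pow_atTop_atTop_of_one_lt one_lt_two).atTop_mul_const hM
  filter_upwards [h1.eventually_ge_atTop ‖ξ‖] with N hN
  rw [← Complex.ofReal_sum, sum_dyadicPiece hM, highFreqSymbol,
    hχ.eq_one ((2 ^ N * M)⁻¹ • ξ)]
  have h0 : (0 : ℝ) < 2 ^ N * M := by positivity
  rw [norm_smul, norm_inv, Real.norm_of_nonneg h0.le, inv_mul_le_iff₀ h0]
  linarith

theorem norm_sum_dyadicPiece_le (hM : 0 < M) (hχ : IsCutoff χ) {t D X : ℝ} (hX0 : 0 ≤ X)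
    (hX : ∀ ξ, |χ ξ| ≤ X) (hD0 : 0 ≤ D)
    (hD : ∀ ξ, M ≤ ‖ξ‖ → |dampedOscillator (a ξ) ‖ξ‖ t| ≤ D)
    (ξ : EuclideanSpace ℝ (Fin n)) (N : ℕ) :
    ‖∑ j ∈ Finset.range N, ((dyadicPiece a χ t (2 ^ j * M) ((2 ^ j * M)⁻¹ • ξ) : ℝ) : ℂ)‖ ≤
      D * (2 * X) := by
  rw [← Complex.ofReal_sum, sum_dyadicPiece hM, Complex.norm_real, norm_mul, Real.norm_eq_abs,
    Real.norm_eq_abs]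
  rcases le_total M ‖ξ‖ with h | h
  · have h2 : |χ ((2 ^ N * M)⁻¹ • ξ) - χ (M⁻¹ • ξ)| ≤ 2 * X := by
      refine (abs_sub _ _).trans ?_
      linarith [hX ((2 ^ N * M)⁻¹ • ξ), hX (M⁻¹ • ξ)]
    have := hD ξ h
    gcongr
  · have h0 : (0 : ℝ) < 2 ^ N * M := by positivity
    rw [hχ.eq_one, hχ.eq_one, sub_self, abs_zero, mul_zero]
    · positivity
    · rw [norm_smul, norm_inv, Real.norm_of_nonneg hM.le, inv_mul_le_iff₀ hM]
      linarith
    · rw [norm_smul, norm_inv, Real.norm_of_nonneg h0.le, inv_mul_le_iff₀ h0]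
      have : M ≤ 2 ^ N * M := le_mul_of_one_le_left hM.le (one_le_pow₀ one_le_two)
      linarith

/-- The bump `lⁿ (1 + l ‖y‖)⁻ⁿ⁻¹` of width `1 / l`; its `L¹` norm does not depend on `l`. -/
def bumpKernel (n : ℕ) (l : ℝ) (y : EuclideanSpace ℝ (Fin n)) : ℝ :=
  l ^ n * ((1 + l * ‖y‖) ^ (n + 1))⁻¹

theorem bumpKernel_nonneg {l : ℝ} (hl : 0 < l) (y : EuclideanSpace ℝ (Fin n)) :
    0 ≤ bumpKernel n l y := by unfold bumpKernel; positivity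

theorem continuous_bumpKernel {l : ℝ} (hl : 0 < l) : Continuous (bumpKernel n l) := by
  unfold bumpKernel
  refine continuous_const.mul (Continuous.inv₀ (by fun_prop) fun y => ?_)
  positivity

/-- Dyadic decomposition of the kernel: convolution with `K₁(t, ·)` is the limit of the convolutions
with partial sums of continuous kernels `k j`, where `k j` is concentrated at distance `(2 ^ j M)⁻¹`
from the origin. The factor `2 π` in the width comes from the normalization of Mathlib's Fourier
transform. -/
theorem exists_dyadic_kernels
    (ha : ContDiffOn ℝ ((n + 1 : ℕ) : WithTop ℕ∞) a {0}ᶜ) (ha_pos : ∀ ξ, ξ ≠ 0 → 0 < a ξ)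
    (hθ : 1 < θ) (hθ2 : θ ≤ 2) (hM : 0 < M) (ha_high : HighFrequencySymbol a θ M)
    (ha_over : ∀ ξ, M ≤ ‖ξ‖ → 4 * ‖ξ‖ ≤ a ξ) (hχ : IsCutoff χ) :
    ∃ c > (0 : ℝ), ∃ C > (0 : ℝ), ∀ t > (0 : ℝ),
      MemLp (highFreqSymbol a χ M t) ∞ volume ∧
      ∃ k : ℕ → EuclideanSpace ℝ (Fin n) → ℂ, (∀ j, Continuous (k j)) ∧
        (∀ j y, ‖k j y‖ ≤ C * (2 ^ j * M) ^ (-θ) *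
          Real.exp (-(c * (t * (2 ^ j * M) ^ (2 - θ)))) *
            bumpKernel n (2 ^ j * M / (2 * Real.pi)) y) ∧
        ∀ (f : 𝓢(EuclideanSpace ℝ (Fin n), ℂ)) x,
          Filter.Tendsto (fun N => ∑ j ∈ Finset.range N, ∫ y, f (x - y) * k j y) Filter.atTop
            (nhds (distributionConv (highFreqKernel a χ M t) f x)) := by
  obtain ⟨c, hc, C₁, hC₁, H⟩ :=
    exists_norm_iteratedFDeriv_dyadicPiece_le ha ha_pos hθ hθ2 hM ha_high ha_over hχ
  obtain ⟨C₂, hC₂, H₂⟩ := exists_norm_fourierInv_le (V := EuclideanSpace ℝ (Fin n)) (n + 1) 4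
  obtain ⟨X, hX0, hX⟩ := hχ.exists_abs_le
  refine ⟨c, hc, C₂ * C₁, by positivity, fun t ht => ?_⟩
  obtain ⟨Hp, Hd⟩ := H t ht
  have hLM : ∀ j : ℕ, M ≤ 2 ^ j * M := fun j =>
    le_mul_of_one_le_left hM.le (one_le_pow₀ one_le_two)
  have hL0 : ∀ j : ℕ, (0 : ℝ) < 2 ^ j * M := fun j => hM.trans_le (hLM j)
  set F : ℕ → EuclideanSpace ℝ (Fin n) → ℂ := fun j η =>
    ((dyadicPiece a χ t (2 ^ j * M) η : ℝ) : ℂ) with hF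
  have hFc : ∀ j, ContDiff ℝ ((n + 1 : ℕ) : WithTop ℕ∞) (F j) := fun j =>
    Complex.ofRealLI.contDiff.comp (Hp _ (hLM j)).1
  have hF4 : ∀ j η, 4 < ‖η‖ → F j η = 0 := fun j η hη => by
    simp only [hF]
    rw [dyadicPiece, hχ.sub_eq_zero_of_ge hη.le, mul_zero, Complex.ofReal_zero]
  have hFsupp : ∀ j, HasCompactSupport (F j) := fun j =>
    HasCompactSupport.intro (isCompact_closedBall 0 4) fun η hη => hF4 j η (by simpa using hη)
  have hFcomp : ∀ j (R : ℝ), 0 < R → Continuous (fun η => F j (R⁻¹ • η)) ∧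
      Integrable (fun η => F j (R⁻¹ • η)) := fun j R hR => by
    have h1 : Continuous (fun η => F j (R⁻¹ • η)) := (hFc j).continuous.comp (by fun_prop)
    refine ⟨h1, ?_⟩
    refine h1.integrable_of_hasCompactSupport ?_
    exact (hFsupp j).comp_smul (inv_ne_zero hR.ne')
  have hm : MemLp (highFreqSymbol a χ M t) ∞ volume := by
    refine memLp_top_of_bound (C := C₁ * M ^ (-θ) * (2 * X)) ?_ ?_
    · exact aestronglyMeasurable_of_tendsto_ae Filter.atTop
        (f := fun N ξ => ∑ j ∈ Finset.range N, F j ((2 ^ j * M)⁻¹ • ξ))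
        (fun N => (continuous_finsetSum _ fun j _ =>
          (hFcomp j _ (hL0 j)).1).aestronglyMeasurable)
        (Filter.Eventually.of_forall fun ξ => tendsto_sum_dyadicPiece hM hχ t ξ)
    · refine Filter.Eventually.of_forall fun ξ => ?_
      exact le_of_tendsto (tendsto_sum_dyadicPiece (a := a) hM hχ t ξ).norm
        (Filter.Eventually.of_forall fun N =>
          norm_sum_dyadicPiece_le hM hχ hX0 hX (by positivity) Hd ξ N)
  refine ⟨hm, ?_⟩
  set l : ℕ → ℝ := fun j => 2 ^ j * M / (2 * Real.pi) with hl
  have hl0 : ∀ j, 0 < l j := fun j => div_pos (hL0 j) (by positivity)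
  have hlL : ∀ j (η : EuclideanSpace ℝ (Fin n)),
      (2 ^ j * M)⁻¹ • ((2 * Real.pi) • η) = (l j)⁻¹ • η := fun j η => by
    rw [smul_smul]
    congr 1
    simp only [hl]
    rw [inv_div]
    ring
  refine ⟨fun j => 𝓕⁻ fun η => F j ((l j)⁻¹ • η), fun j => ?_, fun j y => ?_, fun f x => ?_⟩
  · have := continuous_fourier_of_integrable (hFcomp j (l j) (hl0 j)).2
    have h2 : (𝓕⁻ fun η => F j ((l j)⁻¹ • η)) = fun y => (𝓕 fun η => F j ((l j)⁻¹ • η)) (-y) := by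
      funext y
      rw [Real.fourierInv_eq_fourier_neg]
    beta_reduce
    rw [h2]
    exact this.comp continuous_neg
  · simp only
    rw [fourierInv_comp_inv_smul (F j) (hl0 j) y, norm_smul, finrank_euclideanSpace_fin,
      Real.norm_of_nonneg (by have := hl0 j; positivity)]
    have h := H₂ (F j) (C₁ * (2 ^ j * M) ^ (-θ) *
      Real.exp (-(c * (t * (2 ^ j * M) ^ (2 - θ))))) (by have := hL0 j; positivity) (hFc j)
      (hF4 j) (fun k hk η => by
        have h3 := Complex.ofRealLI.norm_iteratedFDeriv_comp_left (x := η)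
          (Hp _ (hLM j)).1.contDiffAt (i := k) (by exact_mod_cast hk)
        exact h3.le.trans ((Hp _ (hLM j)).2 k hk η)) (l j • y)
    rw [norm_smul, Real.norm_of_nonneg (hl0 j).le] at h
    calc _ ≤ l j ^ n * _ := mul_le_mul_of_nonneg_left h (by have := hl0 j; positivity)
      _ = _ := by rw [bumpKernel]; ring
  · have hm' : MemLp (fun η => highFreqSymbol a χ M t ((2 * Real.pi) • η)) ∞ volume := by
      have hpi : (2 * Real.pi) ≠ 0 := by positivity
      refine memLp_top_of_bound (C := C₁ * M ^ (-θ) * (2 * X)) ?_ ?_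
      · exact aestronglyMeasurable_of_tendsto_ae Filter.atTop
          (f := fun N η => ∑ j ∈ Finset.range N, F j ((2 ^ j * M)⁻¹ • ((2 * Real.pi) • η)))
          (fun N => (continuous_finsetSum _ fun j _ =>
            (hFcomp j _ (hL0 j)).1.comp (continuous_const_smul _)).aestronglyMeasurable)
          (Filter.Eventually.of_forall fun η => tendsto_sum_dyadicPiece hM hχ t _)
      · refine Filter.Eventually.of_forall fun η => ?_
        exact le_of_tendsto (tendsto_sum_dyadicPiece (a := a) hM hχ t _).norm
          (Filter.Eventually.of_forall fun N =>
            norm_sum_dyadicPiece_le hM hχ hX0 hX (by positivity) Hd _ N)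
    refine tendsto_sum_integral_distributionConv hm' (fun j => (hFcomp j (l j) (hl0 j)).2)
      (B := C₁ * M ^ (-θ) * (2 * X)) (fun N η => ?_) (fun η => ?_) f x
    · simp only [← hlL]
      exact norm_sum_dyadicPiece_le hM hχ hX0 hX (by positivity) Hd _ N
    · simp only [← hlL]
      exact tendsto_sum_dyadicPiece hM hχ t _

end Dyadic

/-! ### Dyadic sums and convolution with bumps -/

section Sums

theorem tsum_ofReal_two_pow_rpow_le {s : ℝ} (hs : s < 0) :
    ∃ K > (0 : ℝ), ∑' j : ℕ, ENNReal.ofReal (((2 : ℝ) ^ j) ^ s) ≤ ENNReal.ofReal K := by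
  have e : ∀ j : ℕ, ((2 : ℝ) ^ j) ^ s = ((2 : ℝ) ^ s) ^ j := fun j => by
    rw [← Real.rpow_natCast, ← Real.rpow_natCast, ← Real.rpow_mul (by norm_num),
      ← Real.rpow_mul (by norm_num), mul_comm]
  have h1 : (2 : ℝ) ^ s < 1 := Real.rpow_lt_one_of_one_lt_of_neg (by norm_num) hs
  have hS := summable_geometric_of_lt_one (by positivity) h1
  simp_rw [e]
  rw [← ENNReal.ofReal_tsum_of_nonneg (fun j => by positivity) hS]
  refine ⟨_, ?_, le_rfl⟩
  rw [tsum_geometric_of_lt_one (by positivity) h1]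
  exact inv_pos.mpr (by linarith)

/-- A function that decays like a power at `0` and at `∞` has dyadic sums bounded uniformly in the
base point. -/
theorem tsum_ofReal_comp_two_pow_mul_le {α β : ℝ} (hα : 0 < α) (hβ : 0 < β) {D : ℝ} (hD : 0 < D) :
    ∃ K > (0 : ℝ), ∀ F : ℝ → ℝ, (∀ u > 0, F u ≤ D * u ^ α) → (∀ u > 0, F u ≤ D * u ^ (-β)) →
      ∀ x > 0, ∑' j : ℕ, ENNReal.ofReal (F (2 ^ j * x)) ≤ ENNReal.ofReal K := by
  set G : ℤ → ℝ := fun k => D * min (((2 : ℝ) ^ (k + 1)) ^ α) (((2 : ℝ) ^ k) ^ (-β)) with hG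
  have hG0 : ∀ k, 0 ≤ G k := fun k => by positivity
  have hsum : Summable G := by
    refine Summable.mul_left D (Summable.of_nat_of_neg ?_ ?_)
    · refine Summable.of_nonneg_of_le (fun k => by positivity) (fun k => min_le_right _ _) ?_
      have h1 : (2 : ℝ) ^ (-β) < 1 := Real.rpow_lt_one_of_one_lt_of_neg (by norm_num) (by linarith)
      refine (summable_geometric_of_lt_one (by positivity) h1).congr fun k => ?_
      rw [zpow_natCast, ← Real.rpow_natCast, ← Real.rpow_natCast, ← Real.rpow_mul (by norm_num),
        ← Real.rpow_mul (by norm_num), mul_comm]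
    · refine Summable.of_nonneg_of_le (fun k => by positivity) (fun k => min_le_left _ _) ?_
      have h1 : (2 : ℝ) ^ (-α) < 1 := Real.rpow_lt_one_of_one_lt_of_neg (by norm_num) (by linarith)
      refine ((summable_geometric_of_lt_one (by positivity) h1).mul_left ((2 : ℝ) ^ α)).congr
        fun k => ?_
      rw [← Real.rpow_intCast, ← Real.rpow_natCast, ← Real.rpow_mul (by norm_num),
        ← Real.rpow_mul (by norm_num), ← Real.rpow_add (by norm_num)]
      congr 1
      push_cast
      ring
  refine ⟨∑' k, G k, ?_, fun F hF1 hF2 x hx => ?_⟩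
  · exact hsum.tsum_pos hG0 0 (by positivity)
  obtain ⟨m, hm1, hm2⟩ := exists_mem_Ico_zpow hx (one_lt_two (α := ℝ))
  calc ∑' j : ℕ, ENNReal.ofReal (F (2 ^ j * x))
      ≤ ∑' j : ℕ, ENNReal.ofReal (G ((j : ℤ) + m)) := by
        refine ENNReal.tsum_le_tsum fun j => ENNReal.ofReal_le_ofReal ?_
        have hu : (0 : ℝ) < 2 ^ j * x := by positivity
        have e1 : (2 : ℝ) ^ ((j : ℤ) + m) ≤ 2 ^ j * x := by
          rw [zpow_add₀ (by norm_num), zpow_natCast]; gcongr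
        have e2 : 2 ^ j * x ≤ (2 : ℝ) ^ ((j : ℤ) + m + 1) := by
          rw [add_assoc, zpow_add₀ (by norm_num), zpow_natCast]; gcongr
        simp only [hG]
        rcases min_choice (((2 : ℝ) ^ ((j : ℤ) + m + 1)) ^ α) (((2 : ℝ) ^ ((j : ℤ) + m)) ^ (-β))
          with h | h
        · rw [h]
          exact (hF1 _ hu).trans (by gcongr)
        · rw [h]
          refine (hF2 _ hu).trans ?_
          gcongr ?_ * ?_
          exact Real.rpow_le_rpow_of_nonpos (by positivity) e1 (by linarith)
    _ ≤ ∑' k : ℤ, ENNReal.ofReal (G k) :=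
        ENNReal.tsum_comp_le_tsum_of_injective (f := fun j : ℕ => (j : ℤ) + m)
          (fun i j h => by simpa using h) (fun k => ENNReal.ofReal (G k))
    _ = ENNReal.ofReal (∑' k, G k) := (ENNReal.ofReal_tsum_of_nonneg hG0 hsum).symm

theorem exists_exp_neg_le_rpow_neg {N : ℝ} (hN : 0 ≤ N) :
    ∃ D > (0 : ℝ), ∀ y > 0, Real.exp (-y) ≤ D * y ^ (-N) := by
  obtain ⟨k, hk⟩ := exists_nat_ge N
  refine ⟨(k.factorial : ℝ) + 1, by positivity, fun y hy => ?_⟩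
  have hyN : 0 < y ^ N := by positivity
  rw [Real.rpow_neg hy.le, ← div_eq_mul_inv, le_div_iff₀ hyN, Real.exp_neg,
    inv_mul_le_iff₀ (Real.exp_pos _)]
  rcases le_total y 1 with h | h
  · have h1 : y ^ N ≤ 1 := Real.rpow_le_one hy.le h hN
    have h2 : 1 ≤ Real.exp y := Real.one_le_exp hy.le
    have h3 : (0 : ℝ) ≤ k.factorial := by positivity
    nlinarith
  · have h1 : y ^ N ≤ y ^ k := by
      rw [← Real.rpow_natCast]; exact Real.rpow_le_rpow_of_exponent_le h hk
    have h2 := Real.pow_div_factorial_le_exp y hy.le k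
    rw [div_le_iff₀ (by positivity)] at h2
    nlinarith [Real.exp_pos y]

/-- The sum over the frequencies `u = 2 ^ j` of `u ^ s exp (-c t u ^ δ)` is dominated by
`u ≈ t ^ (-1 / δ)`. -/
theorem tsum_two_pow_rpow_mul_exp_le {s δ c : ℝ} (hs : 0 < s) (hδ : 0 < δ) (hc : 0 < c) :
    ∃ K > (0 : ℝ), ∀ t > (0 : ℝ),
      ∑' j : ℕ, ENNReal.ofReal (((2 : ℝ) ^ j) ^ s * Real.exp (-(c * (t * ((2 : ℝ) ^ j) ^ δ)))) ≤
        ENNReal.ofReal (K * t ^ (-(1 / δ) * s)) := by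
  obtain ⟨D, hD, H⟩ := exists_exp_neg_le_rpow_neg (N := 2 * s / δ) (by positivity)
  obtain ⟨K, hK, HK⟩ := tsum_ofReal_comp_two_pow_mul_le hs hs
    (D := max 1 (D * c ^ (-(2 * s / δ)))) (by positivity)
  refine ⟨K, hK, fun t ht => ?_⟩
  have h := HK (fun u => u ^ s * Real.exp (-(c * u ^ δ))) (fun u hu => ?_) (fun u hu => ?_)
    (t ^ (1 / δ)) (by positivity)
  · rw [ENNReal.ofReal_mul hK.le, mul_comm]
    refine le_trans (le_of_eq ?_) (mul_le_mul_right h _)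
    rw [← ENNReal.tsum_mul_left]
    refine tsum_congr fun j => ?_
    rw [← ENNReal.ofReal_mul (by positivity)]
    congr 1
    rw [Real.mul_rpow (by positivity) (by positivity), Real.mul_rpow (by positivity)
      (by positivity), ← Real.rpow_mul ht.le (1 / δ) δ, one_div_mul_cancel hδ.ne', Real.rpow_one,
      ← Real.rpow_mul ht.le (1 / δ) s, mul_comm (((2 : ℝ) ^ j) ^ δ) t]
    have e : t ^ (1 / δ * s) * t ^ (-(1 / δ) * s) = 1 := by
      rw [← Real.rpow_add ht, ← add_mul, add_neg_cancel, zero_mul, Real.rpow_zero]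
    linear_combination (-(((2 : ℝ) ^ j) ^ s *
      Real.exp (-(c * (t * ((2 : ℝ) ^ j) ^ δ))))) * e
  · calc u ^ s * Real.exp (-(c * u ^ δ)) ≤ u ^ s * 1 := by
          gcongr
          rw [Real.exp_le_one_iff]
          have : 0 ≤ c * u ^ δ := by positivity
          linarith
      _ = 1 * u ^ s := by ring
      _ ≤ _ := by gcongr; exact le_max_left _ _
  · calc u ^ s * Real.exp (-(c * u ^ δ)) ≤ u ^ s * (D * (c * u ^ δ) ^ (-(2 * s / δ))) := by
          gcongr
          exact H _ (by positivity)
      _ = (D * c ^ (-(2 * s / δ))) * u ^ (-s) := by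
          rw [Real.mul_rpow hc.le (by positivity), ← Real.rpow_mul hu.le]
          have : δ * -(2 * s / δ) = -(2 * s) := by field_simp
          rw [this]
          have e : u ^ (-s) = u ^ s * u ^ (-(2 * s)) := by
            rw [← Real.rpow_add hu]; congr 1; ring
          rw [e]
          ring
      _ ≤ _ := by gcongr; exact le_max_right _ _

/-- Without a power of the frequency, about `log (1 / t)` terms contribute for small `t`; this costs
an arbitrarily small power of `t`. -/
theorem tsum_exp_two_pow_le {δ c ε : ℝ} (hδ : 0 < δ) (hc : 0 < c) (hε : 0 < ε) :
    ∃ K > (0 : ℝ), ∀ t > (0 : ℝ),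
      ∑' j : ℕ, ENNReal.ofReal (Real.exp (-(c * (t * ((2 : ℝ) ^ j) ^ δ)))) ≤
        ENNReal.ofReal (K * t ^ (-ε)) := by
  obtain ⟨D, hD, H⟩ := exists_exp_neg_le_rpow_neg hε.le
  obtain ⟨K, hK, HK⟩ := tsum_ofReal_two_pow_rpow_le (s := -(δ * ε)) (by nlinarith)
  refine ⟨D * c ^ (-ε) * K, by positivity, fun t ht => ?_⟩
  calc _ ≤ ∑' j : ℕ, ENNReal.ofReal (D * c ^ (-ε) * t ^ (-ε)) *
        ENNReal.ofReal (((2 : ℝ) ^ j) ^ (-(δ * ε))) := by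
        refine ENNReal.tsum_le_tsum fun j => ?_
        rw [← ENNReal.ofReal_mul (by positivity)]
        refine ENNReal.ofReal_le_ofReal ((H _ (by positivity)).trans (le_of_eq ?_))
        rw [Real.mul_rpow hc.le (by positivity), Real.mul_rpow ht.le (by positivity),
          ← Real.rpow_mul (by positivity), mul_neg]
        ring
    _ = ENNReal.ofReal (D * c ^ (-ε) * t ^ (-ε)) *
        ∑' j : ℕ, ENNReal.ofReal (((2 : ℝ) ^ j) ^ (-(δ * ε))) := ENNReal.tsum_mul_left
    _ ≤ ENNReal.ofReal (D * c ^ (-ε) * t ^ (-ε)) * ENNReal.ofReal K := by gcongr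
    _ = _ := by rw [← ENNReal.ofReal_mul (by positivity)]; congr 1; ring

end Sums

section Bounds

variable {n : ℕ}

theorem lintegral_bumpKernel_one_lt_top :
    ∫⁻ y, ENNReal.ofReal (bumpKernel n 1 y) < ∞ := by
  have h := finite_integral_one_add_norm (E := EuclideanSpace ℝ (Fin n)) (μ := volume)
    (r := (n + 1 : ℕ)) (by rw [finrank_euclideanSpace_fin]; push_cast; linarith)
  refine lt_of_eq_of_lt (lintegral_congr fun y => ?_) h
  rw [bumpKernel, one_pow, one_mul, one_mul, Real.rpow_neg (by positivity), Real.rpow_natCast]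

theorem lintegral_bumpKernel {l : ℝ} (hl : 0 < l) :
    ∫⁻ y, ENNReal.ofReal (bumpKernel n l y) = ∫⁻ y, ENNReal.ofReal (bumpKernel n 1 y) := by
  have h := lintegral_comp_inv_smul volume (inv_pos.mpr hl)
    (fun y : EuclideanSpace ℝ (Fin n) => ENNReal.ofReal (bumpKernel n 1 y))
  have e : ∀ y : EuclideanSpace ℝ (Fin n), ENNReal.ofReal (bumpKernel n l y) =
      ENNReal.ofReal (l ^ n) * ENNReal.ofReal (bumpKernel n 1 (l⁻¹⁻¹ • y)) := by
    intro y
    rw [← ENNReal.ofReal_mul (by positivity), bumpKernel, bumpKernel, inv_inv, norm_smul,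
      Real.norm_of_nonneg hl.le]
    simp
  simp_rw [e]
  rw [lintegral_const_mul' _ _ ENNReal.ofReal_ne_top, h, ← mul_assoc,
    ← ENNReal.ofReal_mul (by positivity), finrank_euclideanSpace_fin, ← mul_pow,
    mul_inv_cancel₀ hl.ne']
  simp

/-- `L^p → L^q` bound for the convolution with `bumpKernel`. -/
theorem eLpNorm_bumpKernel_conv_le {p q : ℝ≥0∞} (hp : 1 ≤ p) (hpq : p ≤ q) :
    ∃ I > (0 : ℝ), ∀ l > (0 : ℝ), ∀ f : EuclideanSpace ℝ (Fin n) → ℝ≥0∞, Measurable f →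
      eLpNorm f p volume ≤ 1 →
      eLpNorm (fun x => ∫⁻ y, ENNReal.ofReal (bumpKernel n l y) * f (x - y)) q volume ≤
        ENNReal.ofReal (I * l ^ (n * ((1 / p).toReal - (1 / q).toReal))) := by
  set I := ∫⁻ y, ENNReal.ofReal (bumpKernel n 1 y) with hI
  have hIt : I < ∞ := lintegral_bumpKernel_one_lt_top
  set r := (1 / p).toReal - (1 / q).toReal with hr
  have hp' : (1 / p).toReal ≤ 1 := by
    rw [← ENNReal.toReal_one]
    refine ENNReal.toReal_mono ENNReal.one_ne_top ?_
    rw [one_div]; exact ENNReal.inv_le_one.mpr hp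
  have hq' : 0 ≤ (1 / q).toReal := ENNReal.toReal_nonneg
  have hr1 : 0 ≤ 1 - r := by rw [hr]; linarith
  have hr0 : 0 ≤ r := by
    rw [hr, sub_nonneg]
    refine ENNReal.toReal_mono ?_ ?_
    · rw [one_div]; exact ENNReal.inv_ne_top.mpr (zero_lt_one.trans_le hp).ne'
    · rw [one_div, one_div]; exact ENNReal.inv_le_inv.mpr hpq
  have hIr : I ^ (1 - r) ≠ ∞ := ENNReal.rpow_ne_top_of_nonneg hr1 hIt.ne
  refine ⟨(I ^ (1 - r)).toReal + 1, by positivity, fun l hl f hf hf1 => ?_⟩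
  refine (eLpNorm_lconvolution_le volume hp hpq
    (continuous_bumpKernel hl).measurable.ennreal_ofReal (I := I) (B := ENNReal.ofReal (l ^ n))
    (lintegral_bumpKernel hl).le (fun y => ?_) hf hf1).trans ?_
  · refine ENNReal.ofReal_le_ofReal ?_
    rw [bumpKernel]
    refine mul_le_of_le_one_right (by positivity) (inv_le_one_of_one_le₀ (one_le_pow₀ ?_))
    have : 0 ≤ l * ‖y‖ := by positivity
    linarith
  · rw [ENNReal.ofReal_mul (by positivity), ← hr]
    gcongr
    · rw [ENNReal.ofReal_add (by positivity) zero_le_one, ENNReal.ofReal_toReal hIr]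
      exact le_self_add
    · rw [ENNReal.ofReal_rpow_of_pos (by positivity), ← Real.rpow_natCast,
        ← Real.rpow_mul hl.le]

variable {k : ℕ → EuclideanSpace ℝ (Fin n) → ℂ} {A l : ℕ → ℝ}
  {f : 𝓢(EuclideanSpace ℝ (Fin n), ℂ)} {T : EuclideanSpace ℝ (Fin n) → ℂ}

theorem enorm_integral_mul_kernel_le (hA : ∀ j, 0 ≤ A j)
    (hk : ∀ j y, ‖k j y‖ ≤ A j * bumpKernel n (l j) y) (j : ℕ) (x : EuclideanSpace ℝ (Fin n)) :
    ‖∫ y, f (x - y) * k j y‖ₑ ≤ ENNReal.ofReal (A j) *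
      ∫⁻ y, ENNReal.ofReal (bumpKernel n (l j) y) * ‖f (x - y)‖ₑ := by
  refine (enorm_integral_le_lintegral_enorm _).trans ?_
  rw [← lintegral_const_mul' _ _ ENNReal.ofReal_ne_top]
  refine lintegral_mono fun y => ?_
  simp only
  rw [enorm_mul, mul_comm, ← mul_assoc, ← ENNReal.ofReal_mul (hA j)]
  gcongr
  rw [← ofReal_norm]
  exact ENNReal.ofReal_le_ofReal (hk j y)

theorem enorm_le_tsum_of_tendsto (hA : ∀ j, 0 ≤ A j)
    (hk : ∀ j y, ‖k j y‖ ≤ A j * bumpKernel n (l j) y)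
    (hT : ∀ x, Filter.Tendsto (fun N => ∑ j ∈ Finset.range N, ∫ y, f (x - y) * k j y) Filter.atTop
      (nhds (T x))) (x : EuclideanSpace ℝ (Fin n)) :
    ‖T x‖ₑ ≤ ∑' j, ENNReal.ofReal (A j) *
      ∫⁻ y, ENNReal.ofReal (bumpKernel n (l j) y) * ‖f (x - y)‖ₑ := by
  refine le_of_tendsto ((continuous_enorm.tendsto _).comp (hT x))
    (Filter.Eventually.of_forall fun N => ?_)
  refine (enorm_sum_le _ _).trans ?_
  exact (Finset.sum_le_sum fun j _ => enorm_integral_mul_kernel_le hA hk j x).trans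
    (ENNReal.sum_le_tsum _)

theorem eLpNorm_le_tsum_of_tendsto {q : ℝ≥0∞} (hq : 1 ≤ q) (hA : ∀ j, 0 ≤ A j)
    (hkc : ∀ j, Continuous (k j)) (hk : ∀ j y, ‖k j y‖ ≤ A j * bumpKernel n (l j) y)
    (hT : ∀ x, Filter.Tendsto (fun N => ∑ j ∈ Finset.range N, ∫ y, f (x - y) * k j y) Filter.atTop
      (nhds (T x))) :
    eLpNorm T q volume ≤ ∑' j, ENNReal.ofReal (A j) * eLpNorm (fun x =>
      ∫⁻ y, ENNReal.ofReal (bumpKernel n (l j) y) * ‖f (x - y)‖ₑ) q volume := by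
  have hm : ∀ j, AEStronglyMeasurable (fun x => ∫ y, f (x - y) * k j y) volume := fun j => by
    refine (StronglyMeasurable.integral_prod_right
      (f := fun x y => f (x - y) * k j y) ?_).aestronglyMeasurable
    have h1 := hkc j
    have h2 := f.continuous
    exact Continuous.stronglyMeasurable (by simp only [Function.uncurry_def]; fun_prop)
  refine (Lp.eLpNorm_lim_le_liminf_eLpNorm
    (f := fun N => ∑ j ∈ Finset.range N, fun x => ∫ y, f (x - y) * k j y)
    (fun N => Finset.aestronglyMeasurable_sum _ fun j _ => hm j) T
    (Filter.Eventually.of_forall fun x => by simpa using hT x)).trans ?_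
  refine Filter.liminf_le_of_le (by isBoundedDefault) fun b hb => ?_
  obtain ⟨N, hN⟩ := hb.exists
  refine hN.trans ((eLpNorm_sum_le (fun j _ => hm j) hq).trans ?_)
  refine le_trans (Finset.sum_le_sum fun j _ => ?_) (ENNReal.sum_le_tsum _)
  exact eLpNorm_le_nnreal_smul_eLpNorm_of_ae_le_mul' (c := (A j).toNNReal)
    (Filter.Eventually.of_forall fun x => enorm_integral_mul_kernel_le hA hk j x) q

end Bounds

/-! ### Operator norms -/

section Estimates

variable {n : ℕ} {a χ : EuclideanSpace ℝ (Fin n) → ℝ} {θ M : ℝ}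

/-- Half of the decay of each dyadic piece gives an exponential factor that is uniform in the
frequency; the other half is left for the summation. -/
theorem exp_neg_two_pow_mul_rpow_le {δ c t : ℝ} (hδ : 0 ≤ δ) (hc : 0 < c) (hM : 0 < M)
    (ht : 0 < t) (j : ℕ) :
    Real.exp (-(c * (t * (2 ^ j * M) ^ δ))) ≤
      Real.exp (-(c * M ^ δ / 2) * t) *
        Real.exp (-(c * M ^ δ / 2 * (t * ((2 : ℝ) ^ j) ^ δ))) := by
  rw [← Real.exp_add, Real.exp_le_exp, Real.mul_rpow (by positivity) hM.le]
  have h1 : (1 : ℝ) ≤ ((2 : ℝ) ^ j) ^ δ :=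
    Real.one_le_rpow (one_le_pow₀ one_le_two) hδ
  have h2 : 0 < c * M ^ δ * t := by positivity
  nlinarith

/-- The operator norm is bounded by the sum of the operator norms of the dyadic pieces. -/
theorem convNorm_highFreqKernel_le_tsum
    (ha : ContDiffOn ℝ ((n + 1 : ℕ) : WithTop ℕ∞) a {0}ᶜ) (ha_pos : ∀ ξ, ξ ≠ 0 → 0 < a ξ)
    (hθ : 1 < θ) (hθ2 : θ ≤ 2) (hM : 0 < M) (ha_high : HighFrequencySymbol a θ M)
    (ha_over : ∀ ξ, M ≤ ‖ξ‖ → 4 * ‖ξ‖ ≤ a ξ) (hχ : IsCutoff χ) {p q : ℝ≥0∞}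
    (hp : 1 ≤ p) (hpq : p ≤ q) {s : ℝ}
    (hs : s = n * ((1 / p).toReal - (1 / q).toReal) - θ) :
    ∃ C > (0 : ℝ), ∃ c > (0 : ℝ), ∀ t > (0 : ℝ),
      convNorm p q (highFreqKernel a χ M t) ≤ ENNReal.ofReal (C * Real.exp (-c * t)) *
        ∑' j : ℕ, ENNReal.ofReal
          (((2 : ℝ) ^ j) ^ s * Real.exp (-(c * (t * ((2 : ℝ) ^ j) ^ (2 - θ))))) := by
  obtain ⟨c, hc, C, hC, H⟩ :=
    exists_dyadic_kernels ha ha_pos hθ hθ2 hM ha_high ha_over hχ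
  obtain ⟨I, hI, HI⟩ := eLpNorm_bumpKernel_conv_le (n := n) hp hpq
  set r : ℝ := n * ((1 / p).toReal - (1 / q).toReal) with hr
  have hπ := Real.pi_pos
  refine ⟨C * I * M ^ (-θ) * (M / (2 * Real.pi)) ^ r, by positivity,
    c * M ^ (2 - θ) / 2, by positivity, fun t ht => ?_⟩
  obtain ⟨-, k, hkc, hk, hT⟩ := H t ht
  refine iSup₂_le fun f hf => ?_
  refine (eLpNorm_le_tsum_of_tendsto (hp.trans hpq) (fun j => by positivity) hkc hk (hT f)).trans ?_
  rw [← ENNReal.tsum_mul_left]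
  refine ENNReal.tsum_le_tsum fun j => ?_
  refine (mul_le_mul_right (HI (2 ^ j * M / (2 * Real.pi)) (by positivity) (fun z => ‖f z‖ₑ)
    f.continuous.enorm.measurable (by rw [eLpNorm_enorm]; exact hf.le)) _).trans ?_
  rw [← ENNReal.ofReal_mul (by positivity), ← ENNReal.ofReal_mul (by positivity)]
  refine ENNReal.ofReal_le_ofReal ?_
  have hexp := exp_neg_two_pow_mul_rpow_le (M := M) (δ := 2 - θ) (by linarith) hc hM ht j
  have e : ((2 : ℝ) ^ j * M) ^ (-θ) * (2 ^ j * M / (2 * Real.pi)) ^ r =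
      M ^ (-θ) * (M / (2 * Real.pi)) ^ r * ((2 : ℝ) ^ j) ^ s := by
    rw [mul_div_assoc, Real.mul_rpow (by positivity) hM.le,
      Real.mul_rpow (by positivity) (by positivity), hs, sub_eq_neg_add,
      Real.rpow_add (by positivity)]
    ring
  calc _ = C * I * (((2 : ℝ) ^ j * M) ^ (-θ) * (2 ^ j * M / (2 * Real.pi)) ^ r) *
        Real.exp (-(c * (t * (2 ^ j * M) ^ (2 - θ)))) := by ring
    _ ≤ C * I * (((2 : ℝ) ^ j * M) ^ (-θ) * (2 ^ j * M / (2 * Real.pi)) ^ r) *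
        (Real.exp (-(c * M ^ (2 - θ) / 2) * t) *
          Real.exp (-(c * M ^ (2 - θ) / 2 * (t * ((2 : ℝ) ^ j) ^ (2 - θ))))) := by
        gcongr
    _ = _ := by rw [e]; ring

/-- The dyadic kernels sum up to the potential `‖y‖ ^ (θ - n)`: by homogeneity, this is a dyadic sum
of `u ^ (n - θ) (1 + u) ^ (-n - 1)` at `u = 2 ^ j M ‖y‖ / (2 π)`. -/
theorem tsum_bumpKernel_le (hθ : 1 < θ) (hM : 0 < M) (hn : θ < n) :
    ∃ K > (0 : ℝ), ∀ y : EuclideanSpace ℝ (Fin n),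
      ∑' j : ℕ, ENNReal.ofReal ((2 ^ j * M) ^ (-θ) *
        bumpKernel n (2 ^ j * M / (2 * Real.pi)) y) ≤
      ENNReal.ofReal K * ‖y‖ₑ ^ (-(n - θ)) := by
  have hπ := Real.pi_pos
  obtain ⟨K, hK, H⟩ := tsum_ofReal_comp_two_pow_mul_le (α := n - θ) (β := θ + 1) (D := 1)
    (by linarith) (by linarith) one_pos
  have HF := H (fun u => u ^ (n - θ) * ((1 + u) ^ (n + 1))⁻¹) (fun u hu => ?_) (fun u hu => ?_)
  · refine ⟨(2 * Real.pi) ^ (-θ) * K, by positivity, fun y => ?_⟩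
    -- At `y = 0` the right-hand side is `∞`.
    rcases eq_or_ne y 0 with rfl | hy
    · rw [enorm_zero, ENNReal.zero_rpow_of_neg (by linarith), ENNReal.mul_top]
      · exact le_top
      · exact (ENNReal.ofReal_pos.mpr (by positivity)).ne'
    have hy0 : 0 < ‖y‖ := norm_pos_iff.mpr hy
    have h := HF (M / (2 * Real.pi) * ‖y‖) (by positivity)
    have e : ∀ j : ℕ, ENNReal.ofReal ((2 ^ j * M) ^ (-θ) *
        bumpKernel n (2 ^ j * M / (2 * Real.pi)) y) =
        ENNReal.ofReal ((2 * Real.pi) ^ (-θ) * ‖y‖ ^ (-(n - θ))) *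
        ENNReal.ofReal ((2 ^ j * (M / (2 * Real.pi) * ‖y‖)) ^ (n - θ) *
          ((1 + 2 ^ j * (M / (2 * Real.pi) * ‖y‖)) ^ (n + 1))⁻¹) := by
      intro j
      rw [← ENNReal.ofReal_mul (by positivity), bumpKernel]
      congr 1
      have hl : 0 < 2 ^ j * M / (2 * Real.pi) := by positivity
      have e1 : (2 ^ j * (M / (2 * Real.pi) * ‖y‖) : ℝ) = 2 ^ j * M / (2 * Real.pi) * ‖y‖ := by
        ring
      have e2 : (2 ^ j * M : ℝ) = 2 ^ j * M / (2 * Real.pi) * (2 * Real.pi) := by field_simp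
      rw [e1]
      nth_rewrite 1 [e2]
      set l := 2 ^ j * M / (2 * Real.pi)
      rw [Real.mul_rpow hl.le (by positivity), Real.mul_rpow hl.le hy0.le,
        sub_eq_add_neg (n : ℝ) θ, Real.rpow_add hl, Real.rpow_natCast]
      have e3 : ‖y‖ ^ (-((n : ℝ) + -θ)) * ‖y‖ ^ ((n : ℝ) + -θ) = 1 := by
        rw [← Real.rpow_add hy0, neg_add_cancel, Real.rpow_zero]
      linear_combination (-(l ^ (-θ) * (2 * Real.pi) ^ (-θ) * l ^ n *
        ((1 + l * ‖y‖) ^ (n + 1))⁻¹)) * e3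
    simp_rw [e]
    rw [ENNReal.tsum_mul_left]
    refine (mul_le_mul_right h _).trans (le_of_eq ?_)
    rw [← ofReal_norm, ENNReal.ofReal_rpow_of_pos hy0, ← ENNReal.ofReal_mul (by positivity),
      ← ENNReal.ofReal_mul (by positivity)]
    congr 1
    ring
  · rw [one_mul]
    exact mul_le_of_le_one_right (by positivity)
      (inv_le_one_of_one_le₀ (one_le_pow₀ (by linarith)))
  · have h1 : ((1 + u) ^ (n + 1))⁻¹ ≤ (u ^ (n + 1))⁻¹ := by
      gcongr
      linarith
    calc _ ≤ u ^ (n - θ) * (u ^ (n + 1))⁻¹ := by gcongr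
      _ = _ := by
        rw [one_mul, ← Real.rpow_natCast, ← Real.rpow_neg hu.le, ← Real.rpow_add hu]
        congr 1
        push_cast
        ring

/-- The scale-invariant case away from the endpoints. The operator norms of the dyadic pieces no
longer decay in `j`, so the kernels are summed first, and the Hardy–Littlewood–Sobolev inequality
applies to their sum. -/
theorem convNorm_highFreqKernel_le_of_eq (hn : 1 ≤ n)
    (ha : ContDiffOn ℝ ((n + 1 : ℕ) : WithTop ℕ∞) a {0}ᶜ) (ha_pos : ∀ ξ, ξ ≠ 0 → 0 < a ξ)
    (hθ : 1 < θ) (hθ2 : θ ≤ 2) (hM : 0 < M) (ha_high : HighFrequencySymbol a θ M)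
    (ha_over : ∀ ξ, M ≤ ‖ξ‖ → 4 * ‖ξ‖ ≤ a ξ) (hχ : IsCutoff χ) {p q : ℝ≥0∞}
    (hp : 1 < p) (hpq : p ≤ q) (hq : q < ∞)
    (hs : n * ((1 / p).toReal - (1 / q).toReal) = θ) :
    ∃ C > (0 : ℝ), ∃ c > (0 : ℝ), ∀ t > (0 : ℝ),
      convNorm p q (highFreqKernel a χ M t) ≤ ENNReal.ofReal (C * Real.exp (-c * t)) := by
  have hn0 : (0 : ℝ) < n := by exact_mod_cast hn
  have hpt : p ≠ ∞ := (hpq.trans_lt hq).ne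
  have hq1 : 1 < q := hp.trans_le hpq
  have hP : 1 < p.toReal := by
    rw [← ENNReal.toReal_one]; exact (ENNReal.toReal_lt_toReal ENNReal.one_ne_top hpt).mpr hp
  have hQ : 1 < q.toReal := by
    rw [← ENNReal.toReal_one]; exact (ENNReal.toReal_lt_toReal ENNReal.one_ne_top hq.ne).mpr hq1
  have hs' : (n : ℝ) * (1 / p.toReal - 1 / q.toReal) = θ := by
    rw [← hs]; simp [ENNReal.toReal_inv]
  have hlt : 1 / p.toReal - 1 / q.toReal < 1 := by
    have h1 : 1 / p.toReal < 1 := by rw [div_lt_one (by linarith)]; exact hP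
    have h2 : 0 < 1 / q.toReal := by positivity
    linarith
  have hθn : θ < n := by
    rw [← hs']; exact mul_lt_of_lt_one_right hn0 hlt
  have : Nonempty (Fin n) := ⟨⟨0, hn⟩⟩
  obtain ⟨B, hB, HLS⟩ := lintegral_potential_rpow_le
    (volume : Measure (EuclideanSpace ℝ (Fin n))) (l := n - θ) hP hQ
    (by rw [finrank_euclideanSpace_fin]; linarith) (by linarith)
    (by rw [finrank_euclideanSpace_fin, sub_div, div_self hn0.ne', ← hs']; field_simp; ring)
  obtain ⟨K, hK, HK⟩ := tsum_bumpKernel_le (n := n) hθ hM hθn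
  obtain ⟨c, hc, C, hC, H⟩ :=
    exists_dyadic_kernels ha ha_pos hθ hθ2 hM ha_high ha_over hχ
  refine ⟨C * K * (B.toReal + 1), by positivity, c * M ^ (2 - θ) / 2, by positivity,
    fun t ht => ?_⟩
  obtain ⟨-, k, hkc, hk, hT⟩ := H t ht
  refine iSup₂_le fun f hf => ?_
  set E := Real.exp (-(c * M ^ (2 - θ) / 2) * t) with hE
  have hpt' : ∀ x, ‖distributionConv (highFreqKernel a χ M t) f x‖ₑ ≤
      ENNReal.ofReal (C * E * K) * ∫⁻ y, ‖y‖ₑ ^ (-(n - θ)) * ‖f (x - y)‖ₑ := by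
    intro x
    refine (enorm_le_tsum_of_tendsto (fun j => by positivity) hk (hT f) x).trans ?_
    simp_rw [← lintegral_const_mul' _ _ ENNReal.ofReal_ne_top]
    rw [← lintegral_tsum]
    · refine lintegral_mono fun y => ?_
      simp only
      rw [← mul_assoc]
      simp_rw [← mul_assoc]
      rw [ENNReal.tsum_mul_right]
      gcongr
      rw [ENNReal.ofReal_mul (by positivity), mul_assoc]
      refine le_trans ?_ (mul_le_mul_right (HK y) _)
      rw [← ENNReal.tsum_mul_left]
      refine ENNReal.tsum_le_tsum fun j => ?_
      rw [← ENNReal.ofReal_mul (by positivity), ← ENNReal.ofReal_mul (by positivity)]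
      refine ENNReal.ofReal_le_ofReal ?_
      have hb := bumpKernel_nonneg (n := n) (l := 2 ^ j * M / (2 * Real.pi)) (by positivity) y
      have hexp := exp_neg_two_pow_mul_rpow_le (M := M) (δ := 2 - θ) (by linarith) hc hM ht j
      have hexp' : Real.exp (-(c * (t * (2 ^ j * M) ^ (2 - θ)))) ≤ E := by
        refine hexp.trans (mul_le_of_le_one_right (Real.exp_pos _).le ?_)
        rw [Real.exp_le_one_iff, neg_nonpos]
        positivity
      calc _ = C * Real.exp (-(c * (t * (2 ^ j * M) ^ (2 - θ)))) *
            ((2 ^ j * M) ^ (-θ) * bumpKernel n (2 ^ j * M / (2 * Real.pi)) y) := by ring_nf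
        _ ≤ _ := by gcongr
    · intro j
      have h1 := f.continuous
      have h2 := continuous_bumpKernel (n := n) (l := 2 ^ j * M / (2 * Real.pi)) (by positivity)
      exact ((h2.measurable.ennreal_ofReal.mul
        (Continuous.measurable (by fun_prop))).const_mul _).aemeasurable
  have hq0 : q ≠ 0 := (zero_lt_one.trans hq1).ne'
  have hp0 : p ≠ 0 := (zero_lt_one.trans hp).ne'
  have hfp : ∫⁻ x, ‖f x‖ₑ ^ p.toReal ≤ 1 := by
    have h := hf.le
    rw [eLpNorm_eq_lintegral_rpow_enorm_toReal hp0 hpt, one_div,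
      ENNReal.rpow_inv_le_iff (by linarith), ENNReal.one_rpow] at h
    exact h
  have hHLS := HLS (fun z => ‖f z‖ₑ) f.continuous.enorm.measurable hfp
  have hI : eLpNorm (fun x => ∫⁻ y, ‖y‖ₑ ^ (-(n - θ)) * ‖f (x - y)‖ₑ) q volume ≤ B := by
    rw [eLpNorm_eq_lintegral_rpow_enorm_toReal hq0 hq.ne]
    simp only [enorm_eq_self]
    rw [one_div]
    exact (ENNReal.rpow_inv_le_iff (by linarith)).mpr hHLS
  calc _ ≤ ENNReal.ofReal (C * E * K) *
        eLpNorm (fun x => ∫⁻ y, ‖y‖ₑ ^ (-(n - θ)) * ‖f (x - y)‖ₑ) q volume := by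
        refine (eLpNorm_le_nnreal_smul_eLpNorm_of_ae_le_mul' (c := (C * E * K).toNNReal)
          (Filter.Eventually.of_forall fun x => ?_) q)
        rw [enorm_eq_self]
        exact hpt' x
    _ ≤ ENNReal.ofReal (C * E * K) * ENNReal.ofReal (B.toReal + 1) := by
        gcongr
        rw [ENNReal.ofReal_add (by positivity) zero_le_one, ENNReal.ofReal_toReal hB.ne]
        exact hI.trans le_self_add
    _ = _ := by rw [← ENNReal.ofReal_mul (by positivity)]; congr 1; ring

/-- The sub-critical case: the dyadic bounds form a convergent geometric series. -/
theorem convNorm_highFreqKernel_le_of_lt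
    (ha : ContDiffOn ℝ ((n + 1 : ℕ) : WithTop ℕ∞) a {0}ᶜ) (ha_pos : ∀ ξ, ξ ≠ 0 → 0 < a ξ)
    (hθ : 1 < θ) (hθ2 : θ ≤ 2) (hM : 0 < M) (ha_high : HighFrequencySymbol a θ M)
    (ha_over : ∀ ξ, M ≤ ‖ξ‖ → 4 * ‖ξ‖ ≤ a ξ) (hχ : IsCutoff χ) {p q : ℝ≥0∞}
    (hp : 1 ≤ p) (hpq : p ≤ q)
    (hs : n * ((1 / p).toReal - (1 / q).toReal) < θ) :
    ∃ C > (0 : ℝ), ∃ c > (0 : ℝ), ∀ t > (0 : ℝ),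
      convNorm p q (highFreqKernel a χ M t) ≤ ENNReal.ofReal (C * Real.exp (-c * t)) := by
  obtain ⟨C, hC, c, hc, H⟩ :=
    convNorm_highFreqKernel_le_tsum ha ha_pos hθ hθ2 hM ha_high ha_over hχ hp hpq rfl
  obtain ⟨K, hK, HK⟩ := tsum_ofReal_two_pow_rpow_le (sub_neg.mpr hs)
  refine ⟨C * K, by positivity, c, hc, fun t ht => (H t ht).trans ?_⟩
  calc _ ≤ ENNReal.ofReal (C * Real.exp (-c * t)) * ENNReal.ofReal K := by
        gcongr
        refine (ENNReal.tsum_le_tsum fun j => ENNReal.ofReal_le_ofReal ?_).trans HK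
        refine mul_le_of_le_one_right (by positivity) ?_
        rw [Real.exp_le_one_iff, neg_nonpos]
        positivity
    _ = _ := by rw [← ENNReal.ofReal_mul (by positivity)]; congr 1; ring

end Estimates

end

theorem theorem2p5 (n : ℕ) (hn : 1 ≤ n)
    (a : EuclideanSpace ℝ (Fin n) → ℝ)
    (ha : ContDiffOn ℝ ((n + 1 : ℕ) : WithTop ℕ∞) a {0}ᶜ)
    (ha_pos : ∀ ξ, ξ ≠ 0 → 0 < a ξ)
    (θ M : ℝ) (hθ : 1 < θ) (hθ2 : θ ≤ 2) (hM : 0 < M)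
    (ha_high : HighFrequencySymbol a θ M)
    (ha_over : ∀ ξ, M ≤ ‖ξ‖ → 4 * ‖ξ‖ ≤ a ξ)
    (χ : EuclideanSpace ℝ (Fin n) → ℝ) (hχ : IsCutoff χ) :
    (∀ t : ℝ, 0 < t → MemLp (highFreqSymbol a χ M t) ∞ volume) ∧
    (θ < 2 →
      ∀ p q : ℝ≥0∞, 1 ≤ p → p ≤ q →
        (¬ IsCriticalEndpoint n θ p q →
          ∃ C > (0 : ℝ), ∃ c > (0 : ℝ), ∀ t : ℝ, 0 < t →
            convNorm p q (highFreqKernel a χ M t) ≤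
              ENNReal.ofReal (C *
                t ^ (-(1 / (2 - θ)) *
                  max ((n : ℝ) * ((1 / p).toReal - (1 / q).toReal) - θ) 0) *
                Real.exp (-c * t))) ∧
        (IsCriticalEndpoint n θ p q →
          ∃ c > (0 : ℝ), ∀ ε > (0 : ℝ), ∃ C > (0 : ℝ), ∀ t : ℝ, 0 < t →
            convNorm p q (highFreqKernel a χ M t) ≤
              ENNReal.ofReal (C * t ^ (-ε) * Real.exp (-c * t)))) ∧
    (θ = 2 →
      ∀ p q : ℝ≥0∞, 1 ≤ p → p ≤ q →
        ((1 < p ∧ q < ∞ ∧ (n : ℝ) * ((1 / p).toReal - (1 / q).toReal) ≤ 2) ∨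
          (p = 1 ∧ (n : ℝ) * (1 - (1 / q).toReal) < 2) ∨
          (q = ∞ ∧ (n : ℝ) * (1 / p).toReal < 2)) →
        ∃ C > (0 : ℝ), ∃ c > (0 : ℝ), ∀ t : ℝ, 0 < t →
          convNorm p q (highFreqKernel a χ M t) ≤
            ENNReal.ofReal (C * Real.exp (-c * t))) := by
  refine ⟨fun t ht => ?_, fun hθ' p q hp hpq => ⟨fun hcrit => ?_, fun hcrit => ?_⟩,
    fun hθ' p q hp hpq h => ?_⟩
  · obtain ⟨c, -, C, -, H⟩ :=
      exists_dyadic_kernels ha ha_pos hθ hθ2 hM ha_high ha_over hχ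
    exact (H t ht).1
  · rcases lt_trichotomy ((n : ℝ) * ((1 / p).toReal - (1 / q).toReal)) θ with hs | hs | hs
    · obtain ⟨C, hC, c, hc, H⟩ := convNorm_highFreqKernel_le_of_lt ha ha_pos hθ hθ2 hM ha_high
        ha_over hχ hp hpq hs
      refine ⟨C, hC, c, hc, fun t ht => ?_⟩
      rw [max_eq_right (by linarith), mul_zero, Real.rpow_zero, mul_one]
      exact H t ht
    · have hp1 : 1 < p := by
        refine lt_of_le_of_ne hp fun h => hcrit (Or.inl ⟨h.symm, ?_⟩)
        rw [← hs, ← h]; simp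
      have hq1 : q < ∞ := by
        refine lt_top_iff_ne_top.mpr fun h => hcrit (Or.inr ⟨h, ?_⟩)
        rw [← hs, h]; simp
      obtain ⟨C, hC, c, hc, H⟩ := convNorm_highFreqKernel_le_of_eq hn ha ha_pos hθ hθ2 hM ha_high
        ha_over hχ hp1 hpq hq1 hs
      refine ⟨C, hC, c, hc, fun t ht => ?_⟩
      rw [max_eq_right (by linarith), mul_zero, Real.rpow_zero, mul_one]
      exact H t ht
    · obtain ⟨C, hC, c, hc, H⟩ := convNorm_highFreqKernel_le_tsum ha ha_pos hθ hθ2 hM ha_high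
        ha_over hχ hp hpq rfl
      obtain ⟨K, hK, HK⟩ := tsum_two_pow_rpow_mul_exp_le (sub_pos.mpr hs) (sub_pos.mpr hθ') hc
      refine ⟨C * K, by positivity, c, hc, fun t ht => (H t ht).trans ?_⟩
      rw [max_eq_left (by linarith)]
      refine (mul_le_mul_right (HK t ht) _).trans (le_of_eq ?_)
      rw [← ENNReal.ofReal_mul (by positivity)]
      congr 1
      ring
  · have hs : (n : ℝ) * ((1 / p).toReal - (1 / q).toReal) - θ = 0 := by
      rcases hcrit with ⟨rfl, h⟩ | ⟨rfl, h⟩ <;> rw [← h] <;> simp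
    obtain ⟨C, hC, c, hc, H⟩ := convNorm_highFreqKernel_le_tsum ha ha_pos hθ hθ2 hM ha_high
      ha_over hχ hp hpq hs.symm
    refine ⟨c, hc, fun ε hε => ?_⟩
    obtain ⟨K, hK, HK⟩ := tsum_exp_two_pow_le (sub_pos.mpr hθ') hc hε
    refine ⟨C * K, by positivity, fun t ht => (H t ht).trans ?_⟩
    simp only [Real.rpow_zero, one_mul]
    refine (mul_le_mul_right (HK t ht) _).trans (le_of_eq ?_)
    rw [← ENNReal.ofReal_mul (by positivity)]
    congr 1
    ring
  · have key : (n : ℝ) * ((1 / p).toReal - (1 / q).toReal) < θ ∨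
        (1 < p ∧ q < ∞ ∧ (n : ℝ) * ((1 / p).toReal - (1 / q).toReal) = θ) := by
      rcases h with ⟨h1, h2, h3⟩ | ⟨rfl, h⟩ | ⟨rfl, h⟩
      · rcases h3.lt_or_eq with h3 | h3
        · exact Or.inl (by rw [hθ']; exact h3)
        · exact Or.inr ⟨h1, h2, by rw [hθ']; exact h3⟩
      · refine Or.inl ?_
        rw [hθ']; simpa using h
      · refine Or.inl ?_
        rw [hθ']; simpa using h
    rcases key with hs | ⟨hp1, hq1, hs⟩
    · exact convNorm_highFreqKernel_le_of_lt ha ha_pos hθ hθ2 hM ha_high ha_over hχ hp hpq hs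
    · exact convNorm_highFreqKernel_le_of_eq hn ha ha_pos hθ hθ2 hM ha_high ha_over hχ hp1 hpq
        hq1 hs
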